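/- **Setting.** Let $\mathbb K$ be an algebraically closed field of characteristic zero, let $n\ge 1$, and let $A=\{\chi_1,\dots,\chi_r\}\subset\mathbb Z^{n-1}$ be a set of $r$ distinct points whose affine span is $\mathbb R^{n-1}$. Put $P=\operatorname{conv}(A)$, and let $K(D)\subset\mathbb R\oplus\mathbb R^{n-1}$ be the cone over $D\subseteq P$, where $D$ is placed at height one via $w\mapsto(1,w)$. Order $\mathbb R^N$ lexicographically, and write $\Psi_i$ or $\Psi(\chi_i)$ for the $i$-th column of $\Psi\in M_{N,r}(\mathbb R)$. **Subdivisions.** A polytopal subdivision $\mathcal Q$ of $(P,A)$ is a finite set of pairs $(Q,A_Q)$ with $A_Q\subseteq A$ and $Q=\operatorname{conv}(A_Q)$ of dimension $n-1$, such that the $Q$ cover $P$, and for any two different pairs $Q\cap Q'$ is empty or a face of both and $A_Q\cap Q\cap Q'=A_{Q'}\cap Q\cap Q'$. It is a triangulation if each $Q$ is a simplex with vertex set $A_Q$. It refines $\mathcal Q'$ if for every $(Q',A_{Q'})\in\mathcal Q'$ the pairs of $\mathcal Q$ with $Q\subseteq Q'$ form a polytopal subdivision of $(Q',A_{Q'})$.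 For $v\in A$ and an affine basis $\Delta\subseteq A$ of $\mathbb R^{n-1}$ with $v=\sum_{w\in\Delta}a_ww$, $\sum_w a_w=1$, let $u_{v,\Delta}=e_v-\sum_{w\in\Delta}a_we_w\in\mathbb R^A$. Let $\mathcal C_{\mathcal Q}$ be the convex cone generated by the vectors $\pm u_{v,\Delta}$ with $\Delta\subseteq A_Q$, $v\in A_Q$, and $u_{v,\Delta}$ with $\Delta\subseteq A_Q$, $v\in A\setminus A_Q$, for all $Q\in\mathcal Q$. The subdivision $\mathcal Q$ is regular if $\mathcal C_{\mathcal Q}\subsetneq\mathcal C_{\mathcal Q'}$ for every polytopal subdivision $\mathcal Q'\ne\mathcal Q$ refined by $\mathcal Q$. **GKZ-cones.** $\Psi\in M_{N,r}(\mathbb R)$ lies in the open GKZ-cone $C(\mathcal Q,N)$ if there is a continuous map $g:K(P)\to\mathbb R^N$, linear on $K(Q)$ for each $Q\in\mathcal Q$, with $g(tx+(1-t)y)\ge tg(x)+(1-t)g(y)$ for all $x,y\in K(P)$, $t\in[0,1]$, with $g(1,v)=\Psi(v)$ for every $v\in\bigcup_{Q}A_Q$ and $g(1,v)>\Psi(v)$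 for every $v\in A\setminus\bigcup_Q A_Q$, and whose domains of linearity are exactly the polytopes of $\mathcal Q$; here a domain of linearity is a maximal set $D\subseteq P$ among the closures of nonempty connected open subsets of $P$ such that $g$ is linear on $K(D)$. **The map $\mathcal V_\Psi$.** For $w\in P$ let $g_\Psi(1,w)$ be the lexicographic maximum of $\{y\in\mathbb R^N : (w,y)\in\operatorname{conv}\{(\chi_i,\Psi_i)\}_{i=1}^r\}$, and extend $g_\Psi$ to $K(P)$ by $g_\Psi(tx)=tg_\Psi(x)$, $t\ge 0$. Let $\hat X_A\subseteq\mathbb K^r$ be the Zariski closure of $\{(c\,\chi_1(t),\dots,c\,\chi_r(t)) : c\in\mathbb K^*,\ t\in(\mathbb K^*)^{n-1}\}$, with coordinate ring $\mathbb K[\hat X_A]$, and let $S\subset\mathbb Z\times\mathbb Z^{n-1}$ be the monoid generated by the $(1,\chi_i)$. The ring $\mathbb K[\hat X_A]$ has the basis $\{f_u\mid u\in S\}$, where $f_u$ is the restriction of any monomial $x_1^{\alpha_1}\cdots x_r^{\alpha_r}$ with $\sum_i\alpha_i(1,\chi_i)=u$. Define $\mathcal V_\Psi:\mathbb K[\hat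 X_A]\to\mathbb R^N\cup\{\infty\}$ by $\mathcal V_\Psi(0)=\infty$ and $\mathcal V_\Psi\bigl(\sum_u a_uf_u\bigr)=\min\{g_\Psi(u)\mid a_u\ne0\}$. **Quasi-valuations.** A quasi-valuation on a $\mathbb K$-algebra $R$ is a map $\nu:R\to\mathbb R^N\cup\{\infty\}$ such that $\nu(x)=\infty$ iff $x=0$, $\nu(x+y)\ge\min\{\nu(x),\nu(y)\}$, $\nu(\lambda x)=\nu(x)$ for $\lambda\in\mathbb K^*$, $\nu(xy)\ge\nu(x)+\nu(y)$, and $\nu(R\setminus\{0\})$ is a discrete subset of $\mathbb R^N$. It is of full rank if $\dim_{\mathbb K}\{x\mid\nu(x)\ge a\}/\{x\mid\nu(x)>a\}\le1$ for all $a\in\mathbb R^N$. **Proposition.** Suppose $N\ge\min\{2n,r\}$. Then there is an open and dense subset $U\subseteq M_{N,r}(\mathbb R)$ in the Euclidean topology such that for every $\Psi\in U$: 1. there is a regular triangulation $\mathcal T$ of $(P,A)$ with $\Psi\in C(\mathcal T,N)$; and 2. $\mathcal V_\Psi$ is a quasi-valuation of full rank. -/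

import Mathlib

namespace GKZ

open MvPolynomial

noncomputable section

/-! ### Marked polytopes and polytopal subdivisions

A point configuration is a family `v : Fin r → (Fin d → ℝ)`; a subset of it is a finset of
indices. The ambient dimension `d` is `n - 1`. -/

section Subdivisions

variable {d r N : ℕ}

/-- The polytope `conv {v i | i ∈ C}` underlying the marked polytope with marking `C`. -/
def poly (v : Fin r → (Fin d → ℝ)) (C : Finset (Fin r)) : Set (Fin d → ℝ) :=
  convexHull ℝ (v '' (C : Set (Fin r)))

/-- The cone over `S`, where `S` is placed at height one via `p ↦ (1, p)`. -/
def coneOver (S : Set (Fin d → ℝ)) : Set (ℝ × (Fin d → ℝ)) :=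
  {x | ∃ t : ℝ, 0 ≤ t ∧ ∃ p ∈ S, x = t • ((1 : ℝ), p)}

/-- `Q` is a polytopal subdivision of the marked polytope with marking `B`. A cell `(Q_i, A_i)`
is recorded by its marking `A_i`, its polytope being `Q_i = conv A_i`. Each cell is
full dimensional, the cells cover `conv B`, two different cells meet in a common (possibly empty)
face, and their markings agree on that face. -/
structure IsSubdivision (v : Fin r → (Fin d → ℝ)) (B : Finset (Fin r))
    (Q : Finset (Finset (Fin r))) : Prop where
  subset : ∀ C ∈ Q, C ⊆ B
  full_dim : ∀ C ∈ Q, affineSpan ℝ (poly v C) = ⊤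
  cover : (⋃ C ∈ Q, poly v C) = poly v B
  face : ∀ C ∈ Q, ∀ C' ∈ Q, C ≠ C' →
    IsExposed ℝ (poly v C) (poly v C ∩ poly v C') ∧
    IsExposed ℝ (poly v C') (poly v C ∩ poly v C')
  marking : ∀ C ∈ Q, ∀ C' ∈ Q, C ≠ C' → ∀ i, v i ∈ poly v C ∩ poly v C' → (i ∈ C ↔ i ∈ C')

/-- A triangulation of `(P, A)`: a polytopal subdivision all of whose cells are simplices marked
by exactly their vertices. -/
structure IsTriangulation (v : Fin r → (Fin d → ℝ)) (Q : Finset (Finset (Fin r))) : Prop where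
  subdivision : IsSubdivision v Finset.univ Q
  simplex : ∀ C ∈ Q, AffineIndependent ℝ (fun i : C => v i)

open Classical in
/-- `Q` refines `Q'`: for every cell `B` of `Q'` the cells of `Q` contained in `B` form
a polytopal subdivision of `B`. -/
def Refines (v : Fin r → (Fin d → ℝ)) (Q Q' : Finset (Finset (Fin r))) : Prop :=
  ∀ B ∈ Q', IsSubdivision v B (Q.filter fun C => poly v C ⊆ poly v B)

/-- `D` is an affine basis of the ambient space. -/
def IsAffBasis (v : Fin r → (Fin d → ℝ)) (D : Finset (Fin r)) : Prop :=
  AffineIndependent ℝ (fun i : D => v i) ∧ affineSpan ℝ (v '' (D : Set (Fin r))) = ⊤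

/-- `u` is the vector `e_k - ∑ a_i e_i` of `ℝ^A`, where `v k = ∑ a_i (v i)` is the affine
expression of `v k` in the affine basis `D`. -/
def IsCircuitVector (v : Fin r → (Fin d → ℝ)) (k : Fin r) (D : Finset (Fin r))
    (u : Fin r → ℝ) : Prop :=
  ∃ a : Fin r → ℝ, (∀ i, i ∉ D → a i = 0) ∧ ∑ i, a i = 1 ∧ ∑ i, a i • v i = v k ∧
    u = Pi.single k 1 - a

/-- The GKZ-condition-cone of `Q`. -/
def conditionCone (v : Fin r → (Fin d → ℝ)) (Q : Finset (Finset (Fin r))) :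
    PointedCone ℝ (Fin r → ℝ) :=
  PointedCone.hull ℝ
    ({u | ∃ C ∈ Q, ∃ D ⊆ C, IsAffBasis v D ∧ ∃ k ∈ C,
        IsCircuitVector v k D u ∨ IsCircuitVector v k D (-u)} ∪
     {u | ∃ C ∈ Q, ∃ D ⊆ C, IsAffBasis v D ∧ ∃ k, k ∉ C ∧ IsCircuitVector v k D u})

/-- `Q` is a regular polytopal subdivision of `(P, A)`: its condition cone is properly contained
in the one of every other polytopal subdivision that is refined by `Q`. -/
def IsRegular (v : Fin r → (Fin d → ℝ)) (Q : Finset (Finset (Fin r))) : Prop :=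
  IsSubdivision v Finset.univ Q ∧
    ∀ Q', IsSubdivision v Finset.univ Q' → Refines v Q Q' → Q' ≠ Q →
      conditionCone v Q < conditionCone v Q'

/-! ### Piecewise linear maps and GKZ-cones

`Fin N → ℝ` is compared lexicographically through `toLex`. -/

/-- `g` is (the restriction of) a linear map on the set `K`. -/
def LinearOn (g : ℝ × (Fin d → ℝ) → (Fin N → ℝ)) (K : Set (ℝ × (Fin d → ℝ))) : Prop :=
  ∃ φ : (ℝ × (Fin d → ℝ)) →ₗ[ℝ] (Fin N → ℝ), Set.EqOn g φ K

/-- `g : K → ℝ^N` is continuous and convex upward for the lexicographic order. -/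
def ConvexUpward (g : ℝ × (Fin d → ℝ) → (Fin N → ℝ)) (K : Set (ℝ × (Fin d → ℝ))) : Prop :=
  ContinuousOn g K ∧ ∀ x ∈ K, ∀ y ∈ K, ∀ t : ℝ, 0 ≤ t → t ≤ 1 →
    toLex (t • g x + (1 - t) • g y) ≤ toLex (g (t • x + (1 - t) • y))

/-- `g` witnesses that `Ψ` lies in the closed GKZ-cone of `Q`: it is `Q`-piecewise linear and
convex upward on `K(P)`, it takes the value `Ψ(v_i)` (the `i`-th column) at all marked points and
a value at least `Ψ(v_i)` at the others. -/
structure IsGKZMap (v : Fin r → (Fin d → ℝ)) (Q : Finset (Finset (Fin r)))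
    (Ψ : Matrix (Fin N) (Fin r) ℝ) (g : ℝ × (Fin d → ℝ) → (Fin N → ℝ)) : Prop where
  linear : ∀ C ∈ Q, LinearOn g (coneOver (poly v C))
  convex : ConvexUpward g (coneOver (poly v Finset.univ))
  eq_marked : ∀ C ∈ Q, ∀ i ∈ C, g (1, v i) = Ψ.col i
  le_unmarked : ∀ i, (∀ C ∈ Q, i ∉ C) → toLex (Ψ.col i) ≤ toLex (g (1, v i))

/-- `D` is a domain in `P`: the closure of a nonempty connected open set contained in `P`. -/
def IsDomainIn (P D : Set (Fin d → ℝ)) : Prop :=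
  ∃ O : Set (Fin d → ℝ), IsOpen O ∧ IsConnected O ∧ O ⊆ P ∧ D = closure O

/-- `D` is a domain of linearity of `g : K(P) → ℝ^N`. -/
def IsDomainOfLinearity (P : Set (Fin d → ℝ)) (g : ℝ × (Fin d → ℝ) → (Fin N → ℝ))
    (D : Set (Fin d → ℝ)) : Prop :=
  Maximal (fun E => IsDomainIn P E ∧ LinearOn g (coneOver E)) D

/-- The closed GKZ-cone. -/
def closedCone (v : Fin r → (Fin d → ℝ)) (Q : Finset (Finset (Fin r))) (N : ℕ) :
    Set (Matrix (Fin N) (Fin r) ℝ) :=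
  {Ψ | ∃ g, IsGKZMap v Q Ψ g}

/-- The open GKZ-cone `C(Q, N)`: the domains of linearity of the map associated to `Ψ` are exactly
the polytopes of `Q`, and the map is strictly larger than `Ψ` at unmarked points. -/
def openCone (v : Fin r → (Fin d → ℝ)) (Q : Finset (Finset (Fin r))) (N : ℕ) :
    Set (Matrix (Fin N) (Fin r) ℝ) :=
  {Ψ | ∃ g, IsGKZMap v Q Ψ g ∧
    (∀ D, IsDomainOfLinearity (poly v Finset.univ) g D ↔ ∃ C ∈ Q, D = poly v C) ∧
    ∀ i, (∀ C ∈ Q, i ∉ C) → toLex (Ψ.col i) < toLex (g (1, v i))}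

/-! ### The map `g_Ψ` -/

open Classical in
/-- The lexicographic maximum of a subset of `ℝ^N` (zero if there is none). -/
def lexMax (S : Set (Fin N → ℝ)) : Fin N → ℝ :=
  if h : ∃ m ∈ S, ∀ y ∈ S, toLex y ≤ toLex m then h.choose else 0

/-- The polytope `Ω_Ψ = conv {(v_i, Ψ(v_i))}`. -/
def omega (v : Fin r → (Fin d → ℝ)) (Ψ : Matrix (Fin N) (Fin r) ℝ) :
    Set ((Fin d → ℝ) × (Fin N → ℝ)) :=
  convexHull ℝ (Set.range fun i => (v i, Ψ.col i))

/-- The piecewise linear map `g_Ψ : K(P) → ℝ^N`: at a point `w` of `P` (at height one) it is the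
lexicographic maximum of the fibre of `Ω_Ψ` over `w`, and it is extended homogeneously. -/
def gMap (v : Fin r → (Fin d → ℝ)) (Ψ : Matrix (Fin N) (Fin r) ℝ) (x : ℝ × (Fin d → ℝ)) :
    Fin N → ℝ :=
  x.1 • lexMax {y | (x.1⁻¹ • x.2, y) ∈ omega v Ψ}

end Subdivisions

/-! ### The embedded toric variety and its homogeneous coordinate ring -/

section Toric

variable {d r : ℕ} (K : Type*) [Field K] (χ : Fin r → (Fin d → ℤ))

/-- The lattice points `χ_i` as points of `ℝ^d`. -/
def realPoints : Fin r → (Fin d → ℝ) := fun i j => (χ i j : ℝ)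

/-- The character `(c, t) ↦ c ^ u.1 * ∏ t_j ^ (u.2 j)` of the torus `K^* × (K^*)^d`. -/
def torusChar (u : ℤ × (Fin d → ℤ)) : Kˣ × (Fin d → Kˣ) →* K where
  toFun p := ((p.1 ^ u.1 * ∏ j, p.2 j ^ u.2 j : Kˣ) : K)
  map_one' := by simp
  map_mul' p q := by
    rw [← Units.val_mul]
    congr 1
    simp only [Prod.fst_mul, Prod.snd_mul, Pi.mul_apply, mul_zpow, Finset.prod_mul_distrib]
    exact mul_mul_mul_comm _ _ _ _

/-- The map `(c, t) ↦ ∑ c χ_i(t) e_i` from `K^* × (K^*)^d` to `K^A`. -/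
def torusMap (p : Kˣ × (Fin d → Kˣ)) : Fin r → K := fun i => torusChar K (1, χ i) p

/-- The affine cone over the embedded toric variety: the Zariski closure of the image
of `torusMap`. -/
def affineConeX : Set (Fin r → K) :=
  zeroLocus K (vanishingIdeal K (Set.range (torusMap K χ)))

/-- The vanishing ideal of the affine cone. -/
def idealX : Ideal (MvPolynomial (Fin r) K) := vanishingIdeal K (affineConeX K χ)

/-- The homogeneous coordinate ring of the embedded toric variety, that is, the coordinate ring of
its affine cone. -/
abbrev CoordRing : Type _ := MvPolynomial (Fin r) K ⧸ idealX K χ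

/-- The weight `∑ α_i (1, χ_i)` of a monomial. -/
def weight (α : Fin r →₀ ℕ) : ℤ × (Fin d → ℤ) := α.sum fun i a => a • ((1 : ℤ), χ i)

/-- The monoid `S` generated by the points `(1, χ_i)`. -/
def monoidS : AddSubmonoid (ℤ × (Fin d → ℤ)) :=
  AddSubmonoid.closure (Set.range fun i => ((1 : ℤ), χ i))

theorem exists_weight_eq (u : monoidS χ) : ∃ α : Fin r →₀ ℕ, weight χ α = u := by
  obtain ⟨u, hu⟩ := u
  obtain ⟨α, hα⟩ := AddSubmonoid.mem_closure_range_iff.1 hu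
  exact ⟨α, hα.symm⟩

theorem weight_mem (α : Fin r →₀ ℕ) : weight χ α ∈ monoidS χ :=
  AddSubmonoid.mem_closure_range_iff.2 ⟨α, rfl⟩

/-- The function `f_u`, `u ∈ S`: the class of any monomial of weight `u`
(see `mk_monomial_eq`). -/
def fElt (u : monoidS χ) : CoordRing K χ :=
  Ideal.Quotient.mk _ (monomial (exists_weight_eq χ u).choose 1)

variable {K χ}

theorem torusChar_add (u w : ℤ × (Fin d → ℤ)) (p : Kˣ × (Fin d → Kˣ)) :
    torusChar K (u + w) p = torusChar K u p * torusChar K w p := by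
  simp only [torusChar, MonoidHom.coe_mk, OneHom.coe_mk]
  rw [← Units.val_mul]
  congr 1
  simp only [Prod.fst_add, Prod.snd_add, Pi.add_apply, zpow_add, Finset.prod_mul_distrib]
  exact mul_mul_mul_comm _ _ _ _

theorem torusChar_zero (p : Kˣ × (Fin d → Kˣ)) : torusChar K 0 p = 1 := by
  simp [torusChar]

theorem mem_idealX {F : MvPolynomial (Fin r) K} :
    F ∈ idealX K χ ↔ ∀ p, eval (torusMap K χ p) F = 0 := by
  constructor
  · intro hF p
    have h := hF (torusMap K χ p) (fun G hG => hG _ ⟨p, rfl⟩)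
    simpa [aeval_eq_eval] using h
  · intro h x hx
    refine hx F ?_
    rintro _ ⟨p, rfl⟩
    simpa [aeval_eq_eval] using h p

theorem torusChar_weight (α : Fin r →₀ ℕ) (p : Kˣ × (Fin d → Kˣ)) :
    torusChar K (weight χ α) p = α.prod fun i a => torusMap K χ p i ^ a := by
  have key : ∀ (a : ℕ) (u : ℤ × (Fin d → ℤ)),
      torusChar K (a • u) p = torusChar K u p ^ a := by
    intro a u
    induction a with
    | zero => rw [zero_smul, torusChar_zero, pow_zero]
    | succ a ih => rw [succ_nsmul, torusChar_add, ih, pow_succ]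
  unfold weight Finsupp.sum Finsupp.prod
  have hsum : ∀ (s : Finset (Fin r)) (w : Fin r → ℤ × (Fin d → ℤ)),
      torusChar K (∑ i ∈ s, w i) p = ∏ i ∈ s, torusChar K (w i) p := by
    intro s w
    classical
    induction s using Finset.induction_on with
    | empty => rw [Finset.sum_empty, torusChar_zero, Finset.prod_empty]
    | insert i s hi ih => rw [Finset.sum_insert hi, torusChar_add, ih, Finset.prod_insert hi]
  rw [hsum]
  exact Finset.prod_congr rfl fun i _ => key _ _

theorem eval_monomial_torusMap (α : Fin r →₀ ℕ) (p : Kˣ × (Fin d → Kˣ)) :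
    eval (torusMap K χ p) (monomial α 1) = torusChar K (weight χ α) p := by
  rw [eval_monomial, one_mul, torusChar_weight]

theorem mk_monomial_eq (α : Fin r →₀ ℕ) :
    (Ideal.Quotient.mk (idealX K χ) (monomial α 1)) = fElt K χ ⟨weight χ α, weight_mem χ α⟩ := by
  refine Ideal.Quotient.eq.2 (mem_idealX.2 fun p => ?_)
  rw [map_sub, eval_monomial_torusMap, eval_monomial_torusMap,
    (exists_weight_eq χ ⟨weight χ α, weight_mem χ α⟩).choose_spec, sub_self]

theorem zpow_two_injective [CharZero K] :
    Function.Injective fun a : ℤ => (Units.mk0 (2 : K) two_ne_zero) ^ a := by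
  intro a b hab
  have h1 : ((2 : K) ^ a) = (2 : K) ^ b := by
    simpa using congrArg Units.val hab
  have h2 : (((2 : ℚ) ^ a : ℚ) : K) = (((2 : ℚ) ^ b : ℚ) : K) := by
    push_cast
    exact h1
  exact zpow_right_injective₀ (by norm_num) (by norm_num) (Rat.cast_injective h2)

theorem torusChar_injective [CharZero K] :
    Function.Injective (torusChar K : ℤ × (Fin d → ℤ) → _) := by
  intro u w h
  have hp : ∀ p : Kˣ × (Fin d → Kˣ),
      p.1 ^ u.1 * ∏ j, p.2 j ^ u.2 j = p.1 ^ w.1 * ∏ j, p.2 j ^ w.2 j :=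
    fun p => Units.ext (DFunLike.congr_fun h p)
  refine Prod.ext ?_ (funext fun j => ?_)
  · refine zpow_two_injective (K := K) ?_
    simpa using hp (Units.mk0 (2 : K) two_ne_zero, 1)
  · refine zpow_two_injective (K := K) ?_
    have := hp (1, Function.update 1 j (Units.mk0 (2 : K) two_ne_zero))
    simp only [one_zpow, one_mul] at this
    rw [Finset.prod_eq_single j, Finset.prod_eq_single j] at this
    · simpa using this
    all_goals simp +contextual [Function.update_of_ne]

/-- Evaluation of a function on the affine cone at the points of the torus. -/
def evalTorus : CoordRing K χ →ₗ[K] (Kˣ × (Fin d → Kˣ) → K) :=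
  (Ideal.Quotient.liftₐ (idealX K χ)
    (AlgHom.pi fun p => aeval (torusMap K χ p))
    (fun F hF => funext fun p => by
      simpa [aeval_eq_eval] using mem_idealX.1 hF p)).toLinearMap

theorem evalTorus_fElt (u : monoidS χ) :
    evalTorus (fElt K χ u) = (torusChar K (u : ℤ × (Fin d → ℤ)) : _ → K) := by
  funext p
  have h := eval_monomial_torusMap (K := K) (χ := χ) (exists_weight_eq χ u).choose p
  rw [(exists_weight_eq χ u).choose_spec] at h
  rw [← h]
  exact congrFun (aeval_eq_eval (torusMap K χ p)) _

theorem fElt_linearIndependent [CharZero K] : LinearIndependent K (fElt K χ) := by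
  refine LinearIndependent.of_comp evalTorus ?_
  have h := (linearIndependent_monoidHom (Kˣ × (Fin d → Kˣ)) K).comp
    (fun u : monoidS χ => torusChar K (u : ℤ × (Fin d → ℤ)))
    (torusChar_injective.comp Subtype.val_injective)
  have e : evalTorus ∘ fElt K χ =
      fun u : monoidS χ => (torusChar K (u : ℤ × (Fin d → ℤ)) : _ → K) :=
    funext evalTorus_fElt
  rw [e]
  exact h

theorem fElt_span : ⊤ ≤ Submodule.span K (Set.range (fElt K χ)) := by
  rintro f -
  obtain ⟨F, rfl⟩ := Ideal.Quotient.mk_surjective f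
  rw [F.as_sum, map_sum]
  refine Submodule.sum_mem _ fun α _ => ?_
  have h : (monomial α (coeff α F)) = (coeff α F) • (monomial α (1 : K)) := by
    rw [smul_monomial, smul_eq_mul, mul_one]
  rw [h]
  have h2 : Ideal.Quotient.mk (idealX K χ) (coeff α F • monomial α (1 : K)) =
      coeff α F • Ideal.Quotient.mk (idealX K χ) (monomial α (1 : K)) := rfl
  rw [h2, mk_monomial_eq]
  exact Submodule.smul_mem _ _ (Submodule.subset_span ⟨_, rfl⟩)

variable (K χ)

/-- The basis `{f_u | u ∈ S}` of the homogeneous coordinate ring. -/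
def fBasis [CharZero K] : Module.Basis (monoidS χ) K (CoordRing K χ) :=
  Module.Basis.mk fElt_linearIndependent fElt_span

end Toric

/-! ### Quasi-valuations -/

section QuasiValuations

variable {K R : Type*} [Field K] [CommRing R] [Algebra K R] {N : ℕ}

/-- A (discrete) quasi-valuation with values in the lexicographically ordered group `ℝ^N`. -/
structure IsQuasiValuation (K : Type*) {R : Type*} [Field K] [CommRing R] [Algebra K R] {N : ℕ}
    (ν : R → WithTop (Lex (Fin N → ℝ))) : Prop where
  eq_top_iff : ∀ x, ν x = ⊤ ↔ x = 0
  min_le_add : ∀ x y, min (ν x) (ν y) ≤ ν (x + y)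
  map_smul : ∀ (c : K) (x : R), c ≠ 0 → ν (c • x) = ν x
  add_le_mul : ∀ x y, ν x + ν y ≤ ν (x * y)
  discrete : DiscreteTopology {a : Fin N → ℝ | ∃ x, ν x = ((toLex a : Lex (Fin N → ℝ)) :
    WithTop (Lex (Fin N → ℝ)))}

variable {ν : R → WithTop (Lex (Fin N → ℝ))}

/-- The subspace `{x | a ≤ ν x}` of the associated filtration. -/
def IsQuasiValuation.ge (h : IsQuasiValuation K ν) (a : Lex (Fin N → ℝ)) : Submodule K R where
  carrier := {x | (a : WithTop (Lex (Fin N → ℝ))) ≤ ν x}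
  zero_mem' := by
    show _ ≤ ν 0
    rw [(h.eq_top_iff 0).2 rfl]; exact le_top
  add_mem' hx hy := (le_min hx hy).trans (h.min_le_add _ _)
  smul_mem' c x hx := by
    show _ ≤ ν (c • x)
    by_cases hc : c = 0
    · rw [hc, zero_smul, (h.eq_top_iff 0).2 rfl]; exact le_top
    · rw [h.map_smul c x hc]; exact hx

/-- The subspace `{x | a < ν x}` of the associated filtration. -/
def IsQuasiValuation.gt (h : IsQuasiValuation K ν) (a : Lex (Fin N → ℝ)) : Submodule K R where
  carrier := {x | (a : WithTop (Lex (Fin N → ℝ))) < ν x}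
  zero_mem' := by
    show _ < ν 0
    rw [(h.eq_top_iff 0).2 rfl]; exact WithTop.coe_lt_top a
  add_mem' hx hy := (lt_min hx hy).trans_le (h.min_le_add _ _)
  smul_mem' c x hx := by
    show _ < ν (c • x)
    by_cases hc : c = 0
    · rw [hc, zero_smul, (h.eq_top_iff 0).2 rfl]; exact WithTop.coe_lt_top a
    · rw [h.map_smul c x hc]; exact hx

/-- The leaf `F_{≥ a} / F_{> a}`. -/
abbrev IsQuasiValuation.Leaf (h : IsQuasiValuation K ν) (a : Lex (Fin N → ℝ)) : Type _ :=
  h.ge a ⧸ (h.gt a).submoduleOf (h.ge a)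

/-- Full rank: all leaves have dimension at most one. -/
def IsQuasiValuation.FullRank (h : IsQuasiValuation K ν) : Prop :=
  ∀ a, Module.rank K (h.Leaf a) ≤ 1

end QuasiValuations

/-- The map `𝒱_Ψ : K[X_A] → ℝ^N ∪ {∞}` sending `f = ∑ a_u f_u` to the lexicographic minimum of
`{g_Ψ(u) | a_u ≠ 0}`, and `0` to `∞`. -/
def vMap {d r N : ℕ} (K : Type*) [Field K] [CharZero K] (χ : Fin r → (Fin d → ℤ))
    (Ψ : Matrix (Fin N) (Fin r) ℝ) (f : CoordRing K χ) : WithTop (Lex (Fin N → ℝ)) :=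
  ((fBasis K χ).repr f).support.inf fun u =>
    ((toLex (gMap (realPoints χ) Ψ ((u.1.1 : ℝ), fun j => (u.1.2 j : ℝ))) : Lex (Fin N → ℝ)) :
      WithTop (Lex (Fin N → ℝ)))

end

end GKZ

/-!
The first row `h` of a matrix `Ψ` is a height function on the configuration. Assume that the
hyperplane spanned by the lifts of an affine basis contains no other lifted point
(`IsGenericHeight`).
The upper facets of the lifted polytope are then simplices. They are recorded by the affine bases
`C` whose hyperplane lies strictly above the lifts of all other points (`upperCells`). Everything
follows from one inequality, `sum_le_interp`: for `μ ≥ 0` the linear map interpolating `h` on an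
upper cell `C` takes at `∑ μ i (1, v i)` a value at least `∑ μ i h i`, with equality only if `μ` is
supported on `C` (`eq_zero_of_interp_le`).

* Upper cells meet in faces, because the difference of their two interpolating maps exposes the
  intersection (`exposed_face`). They cover `P`: over a point in general position the
  support of a representation of maximal height is an upper cell
  (`exists_upperCell_of_generic_point`), and the union of the cells is closed. So they form
  a triangulation.
* Pairing with `h` is nonpositive on the condition cone of the triangulation. A strictly coarser
  subdivision has a cell containing a simplex and a further point, so its condition cone contains
  the negative of a circuit vector, and the pairing is positive there. This gives regularity.
* Since the lexicographic order looks at the first row first, and equality there forces the same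
  combination of columns, the inequality holds lexicographically for all of `Ψ`
  (`toLex_sum_le_interp`). Hence `g_Ψ` is on the cone over `C` the linear interpolation of the
  columns in `C` (`gMap_eq`), it is superadditive, and its domains of linearity are the cells.

If moreover any at most `N` columns are linearly independent, then `g_Ψ` is injective on `K(P)`:
the values at two points are combinations of the columns at the vertices of two simplices, at most
`min (2 * n) r` in number (`injOn_gMap`). So different `f_u` have different values, and the leaves
are at most one-dimensional. The values are discrete because `g_Ψ` is an injective linear map on
each of finitely many cones. Both genericity conditions exclude finitely many closed sets that
meet a suitable line through any given matrix in finitely many points, so they hold on an open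
dense set (`exists_isOpen_dense_isGenericMatrix`).
-/

namespace GKZ

/-! ### Convex hulls and cones in coordinates -/

theorem sum_subtype_of_eq_zero {ι F : Type*} [Fintype ι] [AddCommMonoid F] {C : Finset ι}
    {g : ι → F} (hg : ∀ i, i ∉ C → g i = 0) : ∑ i : C, g i = ∑ i, g i :=
  (Finset.sum_coe_sort C g).trans
    (Finset.sum_subset (Finset.subset_univ C) fun i _ hi => hg i hi)

open Finset in
theorem mem_convexHull_image_finset {ι E : Type*} [Fintype ι] [DecidableEq ι] [AddCommGroup E]
    [Module ℝ E] (f : ι → E) (C : Finset ι) (x : E) :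
    x ∈ convexHull ℝ (f '' (C : Set ι)) ↔ ∃ μ : ι → ℝ, (∀ i, 0 ≤ μ i) ∧ (∀ i, i ∉ C → μ i = 0) ∧
      ∑ i, μ i = 1 ∧ ∑ i, μ i • f i = x := by
  constructor
  · intro hx
    refine convexHull_min (t := {x | ∃ μ : ι → ℝ, (∀ i, 0 ≤ μ i) ∧ (∀ i, i ∉ C → μ i = 0) ∧
      ∑ i, μ i = 1 ∧ ∑ i, μ i • f i = x}) ?_ ?_ hx
    · rintro _ ⟨i, hi, rfl⟩
      refine ⟨Pi.single i 1, fun j => ?_, fun j hj => ?_, by simp, ?_⟩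
      · by_cases h : j = i
        · subst h; simp
        · simp [h]
      · have : j ≠ i := by rintro rfl; exact hj hi
        simp [this]
      · rw [sum_eq_single i] <;> simp +contextual
    · rintro _ ⟨μ, hμ, hC, h1, rfl⟩ _ ⟨ν, hν, hC', h1', rfl⟩ a b ha hb hab
      refine ⟨a • μ + b • ν, fun i => ?_, fun i hi => ?_, ?_, ?_⟩
      · have := hμ i; have := hν i
        simp only [Pi.add_apply, Pi.smul_apply, smul_eq_mul]; positivity
      · simp [hC i hi, hC' i hi]
      · simp [sum_add_distrib, ← mul_sum, h1, h1', hab]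
      · simp [add_smul, mul_smul, sum_add_distrib, ← smul_sum]
  · rintro ⟨μ, hμ, hC, h1, rfl⟩
    rw [← sum_subset (subset_univ C) fun i _ hi => by rw [hC i hi, zero_smul]]
    refine (convex_convexHull ℝ _).sum_mem (fun i _ => hμ i) ?_ fun i hi =>
      subset_convexHull ℝ _ ⟨i, hi, rfl⟩
    rw [← sum_subset (subset_univ C) fun i _ hi => hC i hi] at h1
    exact h1

section Barycentric

variable {d r N : ℕ} {v : Fin r → (Fin d → ℝ)} {C C' : Finset (Fin r)}

/-- The point `(1, v i)` of the cone `K(P)`. -/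
def homog (v : Fin r → (Fin d → ℝ)) (i : Fin r) : ℝ × (Fin d → ℝ) := (1, v i)

theorem sum_smul_homog (μ : Fin r → ℝ) :
    ∑ i, μ i • homog v i = (∑ i, μ i, ∑ i, μ i • v i) := by
  simp [homog, Prod.ext_iff, Prod.fst_sum, Prod.snd_sum]

theorem mem_poly_iff {p : Fin d → ℝ} :
    p ∈ poly v C ↔ ∃ μ : Fin r → ℝ, (∀ i, 0 ≤ μ i) ∧ (∀ i, i ∉ C → μ i = 0) ∧
      ∑ i, μ i • homog v i = (1, p) := by
  simp only [sum_smul_homog, Prod.ext_iff]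
  exact mem_convexHull_image_finset v C p

theorem one_mem_coneOver_iff {S : Set (Fin d → ℝ)} {p : Fin d → ℝ} :
    ((1 : ℝ), p) ∈ coneOver S ↔ p ∈ S := by
  constructor
  · rintro ⟨t, -, q, hq, h⟩
    obtain ⟨h1, h2⟩ := Prod.ext_iff.1 h
    simp only [Prod.smul_mk, smul_eq_mul, mul_one] at h1 h2
    subst h1
    rw [one_smul] at h2
    rwa [h2]
  · exact fun h => ⟨1, zero_le_one, p, h, by simp⟩

theorem mem_coneOver_poly_iff (hC : C.Nonempty) {x : ℝ × (Fin d → ℝ)} :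
    x ∈ coneOver (poly v C) ↔ ∃ μ : Fin r → ℝ, (∀ i, 0 ≤ μ i) ∧ (∀ i, i ∉ C → μ i = 0) ∧
      ∑ i, μ i • homog v i = x := by
  constructor
  · rintro ⟨t, ht, p, hp, rfl⟩
    obtain ⟨μ, h0, hμ, h⟩ := mem_poly_iff.1 hp
    refine ⟨t • μ, fun i => mul_nonneg ht (h0 i), fun i hi => by simp [hμ i hi], ?_⟩
    rw [← h, Finset.smul_sum]
    exact Finset.sum_congr rfl fun i _ => by simp [mul_smul]
  · rintro ⟨μ, h0, hμ, rfl⟩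
    rcases (Finset.sum_nonneg fun i _ => h0 i : 0 ≤ ∑ i, μ i).eq_or_lt with h | h
    · obtain ⟨i, hi⟩ := hC
      have hz : ∀ i, μ i = 0 := fun i =>
        (Finset.sum_eq_zero_iff_of_nonneg fun i _ => h0 i).1 h.symm i (Finset.mem_univ i)
      exact ⟨0, le_rfl, v i, subset_convexHull ℝ _ ⟨i, hi, rfl⟩, by simp [hz]⟩
    · refine ⟨∑ i, μ i, h.le, (∑ i, μ i)⁻¹ • ∑ i, μ i • v i, mem_poly_iff.2
        ⟨(∑ i, μ i)⁻¹ • μ, fun i => mul_nonneg (inv_nonneg.2 h.le) (h0 i),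
          fun i hi => by simp [hμ i hi], ?_⟩, ?_⟩
      · simp only [Pi.smul_apply, smul_eq_mul, mul_smul, ← Finset.smul_sum]
        rw [sum_smul_homog, Prod.smul_mk, smul_eq_mul, inv_mul_cancel₀ h.ne']
      · rw [sum_smul_homog, Prod.smul_mk, smul_inv_smul₀ h.ne', smul_eq_mul, mul_one]

/-! ### Barycentric coordinates of an affine basis -/

theorem exists_bary (h : IsAffBasis v C) :
    ∃ β : (ℝ × (Fin d → ℝ)) →ₗ[ℝ] (Fin r → ℝ), (∀ x i, i ∉ C → β x i = 0) ∧
      ∀ x, ∑ i, β x i • homog v i = x := by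
  classical
  have htop : affineSpan ℝ (Set.range fun i : C => v i) = ⊤ := by
    rw [← h.2]; congr 1; ext; simp
  let b : AffineBasis C ℝ (Fin d → ℝ) := ⟨fun i : C => v i, h.1, htop⟩
  let β : (ℝ × (Fin d → ℝ)) →ₗ[ℝ] (Fin r → ℝ) := LinearMap.pi fun i =>
    if hi : i ∈ C then (b.coord ⟨i, hi⟩).linear ∘ₗ LinearMap.snd ℝ ℝ _ +
      (b.coord ⟨i, hi⟩ 0) • LinearMap.fst ℝ ℝ _ else 0
  have hdec : ∀ (i : C) p, b.coord i p = (b.coord i).linear p + b.coord i 0 := fun i p => by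
    have := congrFun (AffineMap.decomp (b.coord i)) p
    simpa using this
  have hβ1 : ∀ p (i : C), β (1, p) i = b.coord i p := fun p i => by
    rw [hdec]; simp [β]
  have hβ0 : ∀ x i, i ∉ C → β x i = 0 := fun x i hi => by simp [β, hi]
  have h1 : ∀ p, ∑ i, β (1, p) i • homog v i = (1, p) := by
    intro p
    rw [sum_smul_homog]
    refine Prod.ext ?_ ?_
    · refine (sum_subtype_of_eq_zero (C := C) (hβ0 _)).symm.trans ?_
      exact (Finset.sum_congr rfl fun i _ => hβ1 p i).trans (b.sum_coord_apply_eq_one p)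
    · refine (sum_subtype_of_eq_zero (C := C) fun i hi => by simp [hβ0 _ i hi]).symm.trans ?_
      exact (Finset.sum_congr rfl fun (i : C) _ => congrArg (· • v i) (hβ1 p i)).trans
        (b.linear_combination_coord_eq_self p)
  refine ⟨β, hβ0, fun x => ?_⟩
  let Φ : (ℝ × (Fin d → ℝ)) →ₗ[ℝ] (ℝ × (Fin d → ℝ)) :=
    ∑ i, (LinearMap.proj (R := ℝ) i ∘ₗ β).smulRight (homog v i)
  have hΦ : ∀ x, Φ x = ∑ i, β x i • homog v i := fun x => by simp [Φ]
  have hx : x = x.1 • ((1 : ℝ), (0 : Fin d → ℝ)) + (((1 : ℝ), x.2) - (1, 0)) := by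
    ext <;> simp
  rw [← hΦ, hx, map_add, map_smul, map_sub]
  simp only [hΦ, h1]

theorem weights_unique (h : IsAffBasis v C) {μ ν : Fin r → ℝ} (hμ : ∀ i, i ∉ C → μ i = 0)
    (hν : ∀ i, i ∉ C → ν i = 0) (e : ∑ i, μ i • homog v i = ∑ i, ν i • homog v i) : μ = ν := by
  simp only [sum_smul_homog, Prod.ext_iff] at e
  have key := (affineIndependent_iff.1 h.1) Finset.univ (fun i => μ i - ν i)
  rw [sum_subtype_of_eq_zero (g := fun i => μ i - ν i) (fun i hi => by simp [hμ i hi, hν i hi]),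
    sum_subtype_of_eq_zero (g := fun i => (μ i - ν i) • v i)
      (fun i hi => by simp [hμ i hi, hν i hi])] at key
  have := key (by rw [Finset.sum_sub_distrib, e.1, sub_self])
    (by simp only [sub_smul]; rw [Finset.sum_sub_distrib, e.2, sub_self])
  funext i
  by_cases hi : i ∈ C
  · exact sub_eq_zero.1 (this ⟨i, hi⟩ (Finset.mem_univ _))
  · rw [hμ i hi, hν i hi]

open Classical in
/-- The coordinates of a point of `ℝ × ℝ^d` with respect to the linear basis `(1, v i)`, `i ∈ C`,
extended by zero to all indices; the zero map if `C` is not an affine basis. -/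
noncomputable def bary (v : Fin r → (Fin d → ℝ)) (C : Finset (Fin r)) :
    (ℝ × (Fin d → ℝ)) →ₗ[ℝ] (Fin r → ℝ) :=
  if h : IsAffBasis v C then (exists_bary h).choose else 0

theorem bary_eq_zero (x : ℝ × (Fin d → ℝ)) {i : Fin r} (hi : i ∉ C) : bary v C x i = 0 := by
  unfold bary
  split_ifs with h
  · exact (exists_bary h).choose_spec.1 x i hi
  · rfl

theorem sum_bary (h : IsAffBasis v C) (x : ℝ × (Fin d → ℝ)) :
    ∑ i, bary v C x i • homog v i = x := by
  unfold bary
  rw [dif_pos h]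
  exact (exists_bary h).choose_spec.2 x

theorem bary_unique (h : IsAffBasis v C) {μ : Fin r → ℝ} (hμ : ∀ i, i ∉ C → μ i = 0)
    {x : ℝ × (Fin d → ℝ)} (e : ∑ i, μ i • homog v i = x) : bary v C x = μ :=
  weights_unique h (fun _ hi => bary_eq_zero x hi) hμ (by rw [sum_bary h, e])

theorem bary_homog (h : IsAffBasis v C) {k : Fin r} (hk : k ∈ C) :
    bary v C (homog v k) = Pi.single k 1 := by
  refine bary_unique h (fun i hi => ?_) ?_
  · have : i ≠ k := by rintro rfl; exact hi hk
    simp [this]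
  · rw [Finset.sum_eq_single k] <;> simp +contextual

theorem IsAffBasis.nonempty (h : IsAffBasis v C) : C.Nonempty := by
  rw [Finset.nonempty_iff_ne_empty]
  rintro rfl
  have := h.2
  simp only [Finset.coe_empty, Set.image_empty, AffineSubspace.span_empty] at this
  exact AffineSubspace.bot_ne_top ℝ _ _ this

theorem mem_coneOver_iff_bary (h : IsAffBasis v C) {x : ℝ × (Fin d → ℝ)} :
    x ∈ coneOver (poly v C) ↔ ∀ i, 0 ≤ bary v C x i := by
  rw [mem_coneOver_poly_iff h.nonempty]
  constructor
  · rintro ⟨μ, h0, hμ, e⟩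
    rwa [bary_unique h hμ e]
  · exact fun h0 => ⟨bary v C x, h0, fun i hi => bary_eq_zero x hi, sum_bary h x⟩

theorem mem_poly_iff_bary (h : IsAffBasis v C) {p : Fin d → ℝ} :
    p ∈ poly v C ↔ ∀ i, 0 ≤ bary v C (1, p) i := by
  rw [← one_mem_coneOver_iff, mem_coneOver_iff_bary h]

theorem IsAffBasis.card_le (h : IsAffBasis v C) : C.card ≤ d + 1 := by
  have := h.1.card_le_finrank_succ
  refine (by simpa using this : C.card ≤ _).trans ?_
  simpa using Submodule.finrank_le (vectorSpan ℝ (Set.range fun i : C => v i))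

theorem isCircuitVector_iff (h : IsAffBasis v C) {k : Fin r} {u : Fin r → ℝ} :
    IsCircuitVector v k C u ↔ u = Pi.single k 1 - bary v C (homog v k) := by
  constructor
  · rintro ⟨a, ha, h1, h2, rfl⟩
    rw [bary_unique h ha (by rw [sum_smul_homog, h1, h2]; rfl)]
  · rintro rfl
    have := sum_bary h (homog v k)
    rw [sum_smul_homog] at this
    exact ⟨_, fun i hi => bary_eq_zero _ hi, congrArg Prod.fst this, congrArg Prod.snd this, rfl⟩

theorem exists_affBasis_subset (hv : Function.Injective v) {I : Finset (Fin r)}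
    (hI : affineSpan ℝ (v '' (I : Set (Fin r))) = ⊤) : ∃ D ⊆ I, IsAffBasis v D := by
  classical
  obtain ⟨t, ht, hspan, hind⟩ := exists_affineIndependent ℝ (Fin d → ℝ) (v '' (I : Set (Fin r)))
  have himg : v '' ((I.filter fun i => v i ∈ t : Finset (Fin r)) : Set (Fin r)) = t := by
    ext p
    constructor
    · rintro ⟨i, hi, rfl⟩
      exact (Finset.mem_filter.1 hi).2
    · intro hp
      obtain ⟨i, hi, rfl⟩ := ht hp
      exact ⟨i, Finset.mem_filter.2 ⟨hi, hp⟩, rfl⟩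
  refine ⟨I.filter fun i => v i ∈ t, Finset.filter_subset _ _, ?_, by rw [himg, hspan, hI]⟩
  let f : (I.filter fun i => v i ∈ t : Finset (Fin r)) ↪ t :=
    ⟨fun i => ⟨v i, (Finset.mem_filter (p := fun i => v i ∈ t).1 i.2).2⟩, fun i j hij =>
      Subtype.ext (hv (congrArg Subtype.val hij))⟩
  exact hind.comp_embedding f

end Barycentric

/-! ### Linear interpolation on an affine basis -/

section Triangulation

variable {d r N : ℕ} {v : Fin r → (Fin d → ℝ)} {C C' : Finset (Fin r)}

section Interp

variable {F : Type*} [AddCommGroup F] [Module ℝ F]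

/-- The linear map on `ℝ × ℝ^d` with value `f i` at `(1, v i)` for every `i` in the affine
basis `C`. -/
noncomputable def interp (v : Fin r → (Fin d → ℝ)) (C : Finset (Fin r)) (f : Fin r → F) :
    (ℝ × (Fin d → ℝ)) →ₗ[ℝ] F :=
  ∑ i, (LinearMap.proj (R := ℝ) i ∘ₗ bary v C).smulRight (f i)

theorem interp_apply (f : Fin r → F) (x : ℝ × (Fin d → ℝ)) :
    interp v C f x = ∑ i, bary v C x i • f i := by
  simp [interp]

theorem interp_sum_homog (f : Fin r → F) (μ : Fin r → ℝ) :
    interp v C f (∑ i, μ i • homog v i) = ∑ i, μ i • interp v C f (homog v i) := by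
  simp [map_sum]

theorem interp_homog (h : IsAffBasis v C) (f : Fin r → F) {k : Fin r} (hk : k ∈ C) :
    interp v C f (homog v k) = f k := by
  rw [interp_apply, bary_homog h hk, Finset.sum_eq_single k] <;> simp +contextual

theorem interp_of_support (h : IsAffBasis v C) (f : Fin r → F) {μ : Fin r → ℝ}
    (hμ : ∀ i, i ∉ C → μ i = 0) : interp v C f (∑ i, μ i • homog v i) = ∑ i, μ i • f i := by
  rw [interp_apply, bary_unique h hμ rfl]

end Interp

/-! ### The triangulation of a generic height function -/

/-- No point outside an affine basis has its lift by `h` on the hyperplane spanned by the lifts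
of that basis. -/
def IsGenericHeight (v : Fin r → (Fin d → ℝ)) (h : Fin r → ℝ) : Prop :=
  ∀ C, IsAffBasis v C → ∀ k, k ∉ C → h k ≠ interp v C h (homog v k)

open Classical in
/-- The simplices below the upper facets of `conv {(v i, h i)}`: the affine bases `C` for which
the lifts of all other points lie strictly below the hyperplane spanned by the lift of `C`. -/
noncomputable def upperCells (v : Fin r → (Fin d → ℝ)) (h : Fin r → ℝ) :
    Finset (Finset (Fin r)) :=
  Finset.univ.filter fun C => IsAffBasis v C ∧ ∀ k, k ∉ C → h k < interp v C h (homog v k)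

theorem mem_upperCells {h : Fin r → ℝ} : C ∈ upperCells v h ↔
    IsAffBasis v C ∧ ∀ k, k ∉ C → h k < interp v C h (homog v k) := by
  simp [upperCells]

variable {h : Fin r → ℝ}

theorem le_interp (hC : C ∈ upperCells v h) (k : Fin r) : h k ≤ interp v C h (homog v k) := by
  by_cases hk : k ∈ C
  · rw [interp_homog (mem_upperCells.1 hC).1 h hk]
  · exact ((mem_upperCells.1 hC).2 k hk).le

theorem sum_le_interp (hC : C ∈ upperCells v h) {μ : Fin r → ℝ} (hμ : ∀ i, 0 ≤ μ i) :
    ∑ i, μ i • h i ≤ interp v C h (∑ i, μ i • homog v i) := by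
  rw [interp_sum_homog]
  exact Finset.sum_le_sum fun i _ => mul_le_mul_of_nonneg_left (le_interp hC i) (hμ i)

/-- Equality in `sum_le_interp` holds only for combinations of the vertices of `C`. -/
theorem eq_zero_of_interp_le (hC : C ∈ upperCells v h) {μ : Fin r → ℝ} (hμ : ∀ i, 0 ≤ μ i)
    (hle : interp v C h (∑ i, μ i • homog v i) ≤ ∑ i, μ i • h i) {k : Fin r} (hk : k ∉ C) :
    μ k = 0 := by
  by_contra hne
  refine hle.not_gt ?_
  rw [interp_sum_homog]
  exact Finset.sum_lt_sum (fun i _ => mul_le_mul_of_nonneg_left (le_interp hC i) (hμ i))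
    ⟨k, Finset.mem_univ k, mul_lt_mul_of_pos_left ((mem_upperCells.1 hC).2 k hk)
      ((hμ k).lt_of_ne' hne)⟩

theorem interp_le_interp (hC : C ∈ upperCells v h) (hC' : C' ∈ upperCells v h)
    {x : ℝ × (Fin d → ℝ)} (hx : x ∈ coneOver (poly v C)) :
    interp v C h x ≤ interp v C' h x := by
  have hb := (mem_upperCells.1 hC).1
  have := sum_le_interp hC' ((mem_coneOver_iff_bary hb).1 hx)
  rwa [sum_bary hb, ← interp_apply] at this

theorem bary_eq_of_interp_le (hC : C ∈ upperCells v h) (hC' : C' ∈ upperCells v h)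
    {x : ℝ × (Fin d → ℝ)} (hx : x ∈ coneOver (poly v C))
    (hle : interp v C' h x ≤ interp v C h x) : bary v C' x = bary v C x := by
  have hb := (mem_upperCells.1 hC).1
  refine bary_unique (mem_upperCells.1 hC').1 (fun i hi => ?_) (sum_bary hb x)
  refine eq_zero_of_interp_le hC' ((mem_coneOver_iff_bary hb).1 hx) ?_ hi
  rwa [sum_bary hb, ← interp_apply]

theorem mem_coneOver_of_interp_le (hC : C ∈ upperCells v h) (hC' : C' ∈ upperCells v h)
    {x : ℝ × (Fin d → ℝ)} (hx : x ∈ coneOver (poly v C))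
    (hle : interp v C' h x ≤ interp v C h x) : x ∈ coneOver (poly v C') := by
  rw [mem_coneOver_iff_bary (mem_upperCells.1 hC').1, bary_eq_of_interp_le hC hC' hx hle,
    ← mem_coneOver_iff_bary (mem_upperCells.1 hC).1]
  exact hx

/-- At a point of two upper cells the two systems of barycentric coordinates agree. -/
theorem bary_eq_of_mem (hC : C ∈ upperCells v h) (hC' : C' ∈ upperCells v h)
    {x : ℝ × (Fin d → ℝ)} (hx : x ∈ coneOver (poly v C)) (hx' : x ∈ coneOver (poly v C')) :
    bary v C' x = bary v C x :=
  bary_eq_of_interp_le hC hC' hx (interp_le_interp hC' hC hx')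

/-- A point of the polytope that lies in no proper affine subspace spanned by points of the
configuration belongs to an upper cell: the support of a representation of maximal height is
one. -/
theorem exists_upperCell_of_generic_point (hv : Function.Injective v) (hh : IsGenericHeight v h)
    {p : Fin d → ℝ} (hp : p ∈ poly v Finset.univ)
    (hgen : ∀ I : Finset (Fin r), affineSpan ℝ (v '' (I : Set (Fin r))) ≠ ⊤ →
      p ∉ affineSpan ℝ (v '' (I : Set (Fin r)))) :
    ∃ C ∈ upperCells v h, p ∈ poly v C := by
  classical
  let F : Set (Fin r → ℝ) := stdSimplex ℝ (Fin r) ∩ {μ | ∑ i, μ i • homog v i = (1, p)}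
  have hF : IsCompact F := (isCompact_stdSimplex ℝ (Fin r)).inter_right
    (isClosed_eq (by fun_prop) continuous_const)
  have hne : F.Nonempty := by
    obtain ⟨μ, h0, -, e⟩ := mem_poly_iff.1 hp
    refine ⟨μ, ⟨h0, ?_⟩, e⟩
    rw [sum_smul_homog] at e
    exact congrArg Prod.fst e
  obtain ⟨μ, ⟨⟨h0, h1⟩, e⟩, hmax⟩ := hF.exists_isMaxOn (f := fun μ => ∑ i, μ i • h i) hne
    (by fun_prop)
  -- moving `μ` along a linear relation inside the fibre does not increase the height
  have perturb : ∀ u : Fin r → ℝ, ∑ i, u i • homog v i = 0 → (∀ i, μ i = 0 → 0 ≤ u i) →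
      ∑ i, u i • h i ≤ 0 := by
    intro u hu hpos
    have hev : ∀ i, ∀ᶠ ε in nhdsWithin (0 : ℝ) (Set.Ioi 0), 0 ≤ μ i + ε * u i := by
      intro i
      by_cases hi : μ i = 0
      · filter_upwards [self_mem_nhdsWithin] with ε hε
        rw [hi, zero_add]
        exact mul_nonneg (le_of_lt hε) (hpos i hi)
      · have hc : Filter.Tendsto (fun ε : ℝ => μ i + ε * u i) (nhds 0) (nhds (μ i)) := by
          have : Continuous fun ε : ℝ => μ i + ε * u i := by fun_prop
          simpa using this.tendsto 0
        filter_upwards [nhdsWithin_le_nhds (hc.eventually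
          (lt_mem_nhds ((h0 i).lt_of_ne' hi)))] with ε hε using le_of_lt hε
    obtain ⟨ε, hε, hεpos⟩ := ((Filter.eventually_all.2 hev).and self_mem_nhdsWithin).exists
    have e' : ∑ i, (μ + ε • u) i • homog v i = (1, p) := by
      have : ∑ i, (μ + ε • u) i • homog v i =
          ∑ i, μ i • homog v i + ε • ∑ i, u i • homog v i := by
        rw [Finset.smul_sum, ← Finset.sum_add_distrib]
        exact Finset.sum_congr rfl fun i _ => by simp [add_smul, mul_smul]
      rw [this, hu, e, smul_zero, add_zero]
    have hle : ∑ i, (μ + ε • u) i • h i ≤ ∑ i, μ i • h i := by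
      refine hmax ⟨⟨hε, ?_⟩, e'⟩
      rw [sum_smul_homog] at e'
      exact congrArg Prod.fst e'
    have : ∑ i, (μ + ε • u) i • h i = ∑ i, μ i • h i + ε * ∑ i, u i • h i := by
      rw [Finset.mul_sum, ← Finset.sum_add_distrib]
      exact Finset.sum_congr rfl fun i _ => by simp; ring
    rw [this] at hle
    have h2 : ε * ∑ i, u i • h i ≤ 0 := by linarith
    exact le_of_not_gt fun hlt => absurd h2 (not_le.2 (mul_pos hεpos hlt))
  let I : Finset (Fin r) := Finset.univ.filter fun i => μ i ≠ 0
  have hI : ∀ i, i ∉ I → μ i = 0 := fun i hi => by simpa [I] using hi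
  have hpI : p ∈ poly v I := mem_poly_iff.2 ⟨μ, h0, hI, e⟩
  have hspan : affineSpan ℝ (v '' (I : Set (Fin r))) = ⊤ := by
    by_contra hcon
    exact hgen I hcon (convexHull_subset_affineSpan _ hpI)
  obtain ⟨C, hCI, hC⟩ := exists_affBasis_subset hv hspan
  have hrel : ∀ k, ∑ i, (Pi.single k 1 - bary v C (homog v k) : Fin r → ℝ) i • homog v i = 0 := by
    intro k
    simp only [Pi.sub_apply, sub_smul, Finset.sum_sub_distrib, sum_bary hC]
    rw [Finset.sum_eq_single k] <;> simp +contextual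
  have hval : ∀ k, ∑ i, (Pi.single k 1 - bary v C (homog v k) : Fin r → ℝ) i • h i =
      h k - interp v C h (homog v k) := by
    intro k
    simp only [Pi.sub_apply, sub_smul, Finset.sum_sub_distrib, interp_apply]
    rw [Finset.sum_eq_single k] <;> simp +contextual
  have hle : ∀ k, h k ≤ interp v C h (homog v k) := by
    intro k
    have := perturb _ (hrel k) fun i hi => by
      have hiC : i ∉ C := fun hiC => (Finset.mem_filter.1 (hCI hiC)).2 hi
      rw [Pi.sub_apply, bary_eq_zero _ hiC, sub_zero]
      by_cases hik : i = k
      · subst hik; simp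
      · simp [hik]
    rw [hval] at this
    linarith
  have hIC : ∀ k, k ∉ C → μ k = 0 := by
    intro k hk
    by_contra hμk
    have := perturb (-(Pi.single k 1 - bary v C (homog v k))) (by
      simpa only [Pi.neg_apply, neg_smul, Finset.sum_neg_distrib, neg_eq_zero] using hrel k)
      fun i hi => by
        have hiC : i ∉ C := fun hiC => (Finset.mem_filter.1 (hCI hiC)).2 hi
        have hik : i ≠ k := by rintro rfl; exact hμk hi
        simp [bary_eq_zero _ hiC, hik]
    have h3 : ∑ i, (-(Pi.single k 1 - bary v C (homog v k)) : Fin r → ℝ) i • h i =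
        -(h k - interp v C h (homog v k)) := by
      rw [← hval]; simp only [Pi.neg_apply, neg_smul, Finset.sum_neg_distrib]
    rw [h3] at this
    exact hh C hC k hk (le_antisymm (hle k) (by linarith))
  exact ⟨C, mem_upperCells.2 ⟨hC, fun k hk => (hle k).lt_of_ne (hh C hC k hk)⟩,
    mem_poly_iff.2 ⟨μ, h0, hIC, e⟩⟩

theorem dense_compl_affineSubspace {s : AffineSubspace ℝ (Fin d → ℝ)} (hs : s ≠ ⊤) :
    Dense (s : Set (Fin d → ℝ))ᶜ := by
  rw [← interior_eq_empty_iff_dense_compl, ← Set.not_nonempty_iff_eq_empty]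
  intro hne
  refine hs (top_le_iff.1 ?_)
  rw [← isOpen_interior.affineSpan_eq_top hne]
  exact affineSpan_le.2 interior_subset

theorem isCompact_poly : IsCompact (poly v C) :=
  (C.finite_toSet.image v).isCompact_convexHull ℝ

theorem interior_poly_nonempty (hC : affineSpan ℝ (v '' (C : Set (Fin r))) = ⊤) :
    (interior (poly v C)).Nonempty :=
  interior_convexHull_nonempty_iff_affineSpan_eq_top.2 hC

theorem convex_poly : Convex ℝ (poly v C) :=
  convex_convexHull ℝ _

theorem closure_interior_poly (hC : affineSpan ℝ (v '' (C : Set (Fin r))) = ⊤) :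
    closure (interior (poly v C)) = poly v C := by
  rw [convex_poly.closure_interior_eq_closure_of_nonempty_interior
    (interior_poly_nonempty hC)]
  exact isCompact_poly.isClosed.closure_eq

theorem poly_mono (h : C ⊆ C') : poly v C ⊆ poly v C' :=
  convexHull_mono (Set.image_mono (Finset.coe_subset.2 h))

/-- The upper cells cover `P`: they contain a dense subset of it, and their union is closed. -/
theorem iUnion_upperCells (hv : Function.Injective v) (hspan : affineSpan ℝ (Set.range v) = ⊤)
    (hh : IsGenericHeight v h) :
    (⋃ C ∈ upperCells v h, poly v C) = poly v Finset.univ := by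
  refine subset_antisymm (Set.iUnion₂_subset fun C _ => poly_mono (Finset.subset_univ C)) ?_
  let G : Set (Fin d → ℝ) := ⋂ I : {I : Finset (Fin r) //
    affineSpan ℝ (v '' (I : Set (Fin r))) ≠ ⊤}, (affineSpan ℝ (v '' (I.1 : Set (Fin r))) : Set _)ᶜ
  have hG : Dense G := dense_iInter_of_isOpen
    (fun I => (AffineSubspace.closed_of_finiteDimensional _).isOpen_compl)
    fun I => dense_compl_affineSubspace I.2
  have hcl : IsClosed (⋃ C ∈ upperCells v h, poly v C) :=
    (upperCells v h).finite_toSet.isClosed_biUnion fun C _ => isCompact_poly.isClosed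
  rw [← closure_interior_poly (v := v) (C := Finset.univ) (by simpa using hspan)]
  refine closure_minimal ((hG.open_subset_closure_inter isOpen_interior).trans
    (closure_minimal ?_ hcl)) hcl
  rintro p ⟨hp, hpG⟩
  obtain ⟨C, hC, hpC⟩ := exists_upperCell_of_generic_point hv hh (interior_subset hp)
    fun I hI => Set.mem_iInter.1 hpG ⟨I, hI⟩
  exact Set.mem_iUnion₂.2 ⟨C, hC, hpC⟩

theorem exposed_face (hC : C ∈ upperCells v h) (hC' : C' ∈ upperCells v h) :
    IsExposed ℝ (poly v C) (poly v C ∩ poly v C') := by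
  rintro ⟨p, hp, hp'⟩
  -- `φ ≤ 0` on the cone over `C`, with equality exactly on the cone over `C'`
  let φ : (ℝ × (Fin d → ℝ)) →ₗ[ℝ] ℝ := interp v C h - interp v C' h
  let l : (Fin d → ℝ) →L[ℝ] ℝ := LinearMap.toContinuousLinearMap (φ ∘ₗ LinearMap.inr ℝ ℝ _)
  have hl : ∀ q q', l q ≤ l q' ↔ φ (1, q) ≤ φ (1, q') := by
    intro q q'
    have : ∀ q, φ (1, q) = φ (1, 0) + l q := fun q => by
      simp only [l, LinearMap.coe_toContinuousLinearMap', LinearMap.comp_apply,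
        LinearMap.inr_apply, ← map_add]
      simp
    rw [this q, this q', add_le_add_iff_left]
  have hle : ∀ q ∈ poly v C, φ (1, q) ≤ 0 := fun q hq =>
    sub_nonpos.2 (interp_le_interp hC hC' (one_mem_coneOver_iff.2 hq))
  have hge : ∀ q ∈ poly v C', 0 ≤ φ (1, q) := fun q hq =>
    sub_nonneg.2 (interp_le_interp hC' hC (one_mem_coneOver_iff.2 hq))
  refine ⟨l, Set.ext fun q => ⟨fun ⟨hq, hq'⟩ => ⟨hq, fun y hy => ?_⟩, fun ⟨hq, hmax⟩ => ⟨hq, ?_⟩⟩⟩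
  · exact (hl _ _).2 ((hle y hy).trans (hge q hq'))
  · have := (hge p hp').trans ((hl _ _).1 (hmax p hp))
    exact one_mem_coneOver_iff.1 (mem_coneOver_of_interp_le hC hC' (one_mem_coneOver_iff.2 hq)
      (sub_nonneg.1 this))

theorem mem_of_mem_poly (hC : C ∈ upperCells v h) (hC' : C' ∈ upperCells v h) {i : Fin r}
    (hi : v i ∈ poly v C') (hiC : i ∈ C) : i ∈ C' := by
  by_contra hcon
  have hiC' : v i ∈ poly v C := subset_convexHull ℝ _ ⟨i, hiC, rfl⟩
  have e := bary_eq_of_mem hC hC' (one_mem_coneOver_iff.2 hiC') (one_mem_coneOver_iff.2 hi)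
  have e1 : bary v C (1, v i) = Pi.single i 1 := bary_homog (mem_upperCells.1 hC).1 hiC
  have := congrFun e i
  rw [e1, bary_eq_zero _ hcon] at this
  simp at this

theorem isTriangulation_upperCells (hv : Function.Injective v)
    (hspan : affineSpan ℝ (Set.range v) = ⊤) (hh : IsGenericHeight v h) :
    IsTriangulation v (upperCells v h) where
  subdivision :=
    { subset := fun C _ => Finset.subset_univ C
      full_dim := fun C hC => by
        rw [poly, affineSpan_convexHull]
        exact (mem_upperCells.1 hC).1.2
      cover := iUnion_upperCells hv hspan hh
      face := fun C hC C' hC' _ => ⟨exposed_face hC hC', by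
        rw [Set.inter_comm]; exact exposed_face hC' hC⟩
      marking := fun C hC C' hC' _ i hi =>
        ⟨mem_of_mem_poly hC hC' hi.2, mem_of_mem_poly hC' hC hi.1⟩ }
  simplex := fun _ hC => (mem_upperCells.1 hC).1.1

/-! ### Regularity -/

theorem IsAffBasis.eq_of_subset {D : Finset (Fin r)} (hC : IsAffBasis v C) (hD : IsAffBasis v D)
    (hDC : D ⊆ C) : D = C := by
  refine Finset.Subset.antisymm hDC fun k hk => ?_
  by_contra hkD
  have e : bary v C (homog v k) = bary v D (homog v k) :=
    bary_unique hC (fun i hi => bary_eq_zero _ fun hiD => hi (hDC hiD)) (sum_bary hD _)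
  have := congrFun e k
  rw [bary_homog hC hk, bary_eq_zero _ hkD] at this
  simp at this

theorem sum_circuitVector (k : Fin r) :
    ∑ i, (Pi.single k 1 - bary v C (homog v k) : Fin r → ℝ) i * h i =
      h k - interp v C h (homog v k) := by
  simp only [Pi.sub_apply, sub_mul, Finset.sum_sub_distrib, interp_apply, smul_eq_mul]
  rw [Finset.sum_eq_single k] <;> simp +contextual

/-- Pairing with the height function is nonpositive on the condition cone of its upper cells. -/
theorem sum_nonpos_of_mem_conditionCone {u : Fin r → ℝ}
    (hu : u ∈ conditionCone v (upperCells v h)) : ∑ i, u i * h i ≤ 0 := by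
  induction hu using Submodule.span_induction with
  | mem u hu =>
    rcases hu with ⟨C, hC, D, hDC, hD, k, hk, hu⟩ | ⟨C, hC, D, hDC, hD, k, hk, hu⟩
    · obtain ⟨hb, -⟩ := mem_upperCells.1 hC
      obtain rfl := hb.eq_of_subset hD hDC
      have : u = 0 := by
        rcases hu with hu | hu <;> rw [isCircuitVector_iff hD, bary_homog hD hk, sub_self] at hu
        · exact hu
        · exact neg_eq_zero.1 hu
      simp [this]
    · obtain ⟨hb, hlt⟩ := mem_upperCells.1 hC
      obtain rfl := hb.eq_of_subset hD hDC
      rw [isCircuitVector_iff hD] at hu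
      rw [hu, sum_circuitVector]
      exact sub_nonpos.2 (hlt k hk).le
  | zero => simp
  | add x y _ _ hx hy =>
    simp only [Pi.add_apply, add_mul, Finset.sum_add_distrib]
    exact add_nonpos hx hy
  | smul c x _ hx =>
    have : ∑ i, (c • x) i * h i = (c : ℝ) * ∑ i, x i * h i := by
      rw [Finset.mul_sum]
      exact Finset.sum_congr rfl fun i _ => mul_assoc _ _ _
    rw [this]
    exact mul_nonpos_of_nonneg_of_nonpos c.2 hx

/-- If `Q` refines `Q'`, every cell of `Q` lies in a cell of `Q'`, as a polytope and as
a marking. -/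
theorem exists_cell_of_refines {Q Q' : Finset (Finset (Fin r))}
    (hQ : IsSubdivision v Finset.univ Q) (hQ' : IsSubdivision v Finset.univ Q')
    (href : Refines v Q Q') (hC : C ∈ Q) : ∃ B ∈ Q', C ⊆ B ∧ poly v C ⊆ poly v B := by
  classical
  obtain ⟨p, hp⟩ := interior_poly_nonempty (v := v) (C := C) (by
    rw [← hQ.full_dim C hC, poly, affineSpan_convexHull])
  have hpP : p ∈ poly v Finset.univ := poly_mono (Finset.subset_univ C) (interior_subset hp)
  rw [← hQ'.cover] at hpP
  obtain ⟨B, hB, hpB⟩ := Set.mem_iUnion₂.1 hpP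
  rw [← (href B hB).cover] at hpB
  obtain ⟨C', hC', hpC'⟩ := Set.mem_iUnion₂.1 hpB
  obtain ⟨hC'Q, hC'B⟩ := Finset.mem_filter.1 hC'
  have hsub : poly v C ⊆ poly v B := by
    rcases eq_or_ne C C' with rfl | hne
    · exact hC'B
    -- a face of `C` containing an interior point is all of `C`
    obtain ⟨l, hl⟩ := (hQ.face C hC C' hC'Q hne).1 ⟨p, interior_subset hp, hpC'⟩
    have hpl : ∀ y ∈ poly v C, l y ≤ l p := by
      have : p ∈ poly v C ∩ poly v C' := ⟨interior_subset hp, hpC'⟩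
      rw [hl] at this
      exact this.2
    have hmax : IsLocalMax l p := by
      filter_upwards [isOpen_interior.mem_nhds hp] with y hy using hpl y (interior_subset hy)
    have hl0 : l = 0 := hmax.hasFDerivAt_eq_zero l.hasFDerivAt
    intro q hq
    have : q ∈ poly v C ∩ poly v C' := by
      rw [hl]
      exact ⟨hq, fun y _ => by simp [hl0]⟩
    exact hC'B this.2
  exact ⟨B, hB, (href B hB).subset C (Finset.mem_filter.2 ⟨hC, hsub⟩), hsub⟩

/-- If `Q'` is strictly coarser than the upper cells of `h`, some cell of `Q'` contains an upper
cell `C` and a further point `k`; the negative of the corresponding circuit vector lies in the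
condition cone of `Q'` and pairs positively with `h`. -/
theorem isRegular_upperCells (hv : Function.Injective v)
    (hspan : affineSpan ℝ (Set.range v) = ⊤) (hh : IsGenericHeight v h) :
    IsRegular v (upperCells v h) := by
  classical
  have hT := (isTriangulation_upperCells hv hspan hh).subdivision
  refine ⟨hT, fun Q' hQ' href hne => lt_iff_le_not_ge.2 ⟨?_, fun hcon => hne ?_⟩⟩
  · refine Submodule.span_le.2 ?_
    rintro u (⟨C, hC, D, hDC, hD, k, hk, hu⟩ | ⟨C, hC, D, hDC, hD, k, hk, hu⟩)
    · obtain ⟨B, hB, hCB, -⟩ := exists_cell_of_refines hT hQ' href hC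
      exact Submodule.subset_span (Or.inl ⟨B, hB, D, hDC.trans hCB, hD, k, hCB hk, hu⟩)
    · obtain ⟨B, hB, hCB, -⟩ := exists_cell_of_refines hT hQ' href hC
      by_cases hkB : k ∈ B
      · exact Submodule.subset_span (Or.inl ⟨B, hB, D, hDC.trans hCB, hD, k, hkB, Or.inl hu⟩)
      · exact Submodule.subset_span (Or.inr ⟨B, hB, D, hDC.trans hCB, hD, k, hkB, hu⟩)
  · have key : ∀ C ∈ upperCells v h, ∀ B ∈ Q', C ⊆ B → C = B := by
      refine fun C hC B hB hCB => Finset.Subset.antisymm hCB fun k hkB => ?_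
      by_contra hkC
      obtain ⟨hb, hlt⟩ := mem_upperCells.1 hC
      have hmem : -(Pi.single k 1 - bary v C (homog v k)) ∈ conditionCone v Q' :=
        Submodule.subset_span (Or.inl ⟨B, hB, C, hCB, hb, k, hkB, Or.inr
          ((isCircuitVector_iff hb).2 (neg_neg _))⟩)
      have := sum_nonpos_of_mem_conditionCone (hcon hmem)
      simp only [Pi.neg_apply, neg_mul, Finset.sum_neg_distrib] at this
      have e := sum_circuitVector (v := v) (C := C) (h := h) k
      have := hlt k hkC
      linarith
    ext B
    constructor
    · intro hB
      have hne' : (poly v B).Nonempty := by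
        rw [Set.nonempty_iff_ne_empty]
        intro he
        have := hQ'.full_dim B hB
        rw [he, AffineSubspace.span_empty] at this
        exact AffineSubspace.bot_ne_top ℝ _ _ this
      obtain ⟨p, hp⟩ := hne'
      rw [← (href B hB).cover] at hp
      obtain ⟨C, hC, -⟩ := Set.mem_iUnion₂.1 hp
      have hCT := (Finset.mem_filter.1 hC).1
      rw [← key C hCT B hB ((href B hB).subset C hC)]
      exact hCT
    · intro hB
      obtain ⟨B', hB', hsub, -⟩ := exists_cell_of_refines hT hQ' href hB
      rwa [key B hB B' hB' hsub]

/-! ### The map `g_Ψ` on a generic matrix -/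

theorem lexMax_eq {S : Set (Fin N → ℝ)} {m : Fin N → ℝ} (hm : m ∈ S)
    (hmax : ∀ y ∈ S, toLex y ≤ toLex m) : lexMax S = m := by
  have hex : ∃ m ∈ S, ∀ y ∈ S, toLex y ≤ toLex m := ⟨m, hm, hmax⟩
  rw [lexMax, dif_pos hex]
  exact toLex.injective (le_antisymm (hmax _ hex.choose_spec.1) (hex.choose_spec.2 m hm))

theorem mem_omega_iff {Ψ : Matrix (Fin N) (Fin r) ℝ} {p : Fin d → ℝ} {y : Fin N → ℝ} :
    (p, y) ∈ omega v Ψ ↔ ∃ μ : Fin r → ℝ, (∀ i, 0 ≤ μ i) ∧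
      ∑ i, μ i • homog v i = (1, p) ∧ ∑ i, μ i • Ψ.col i = y := by
  have := mem_convexHull_image_finset (fun i => (v i, Ψ.col i)) Finset.univ (p, y)
  rw [Finset.coe_univ, Set.image_univ] at this
  rw [omega, this]
  simp [sum_smul_homog, Prod.ext_iff, Prod.fst_sum, Prod.snd_sum, and_assoc]

variable {Ψ : Matrix (Fin N) (Fin r) ℝ} {z : Fin N}

theorem interp_col_apply (x : ℝ × (Fin d → ℝ)) (j : Fin N) :
    interp v C Ψ.col x j = interp v C (Ψ j) x := by
  simp [interp_apply, Finset.sum_apply]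

theorem toLex_lt_of_first (hz : ∀ j, z ≤ j) {a b : Fin N → ℝ} (hab : a z < b z) :
    toLex a < toLex b :=
  ⟨z, fun j hj => absurd (hz j) (not_le.2 hj), hab⟩

/-- The lexicographic form of `sum_le_interp`. In the case of equality in the first row both sides
are the same combination of the columns in `C`. -/
theorem toLex_sum_le_interp (hz : ∀ j, z ≤ j) (hC : C ∈ upperCells v (Ψ z)) {μ : Fin r → ℝ}
    (hμ : ∀ i, 0 ≤ μ i) :
    toLex (∑ i, μ i • Ψ.col i) ≤ toLex (interp v C Ψ.col (∑ i, μ i • homog v i)) := by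
  rcases (sum_le_interp hC hμ).lt_or_eq with hlt | heq
  · refine (toLex_lt_of_first hz ?_).le
    rw [interp_col_apply]
    simpa [Finset.sum_apply] using hlt
  · rw [interp_of_support (mem_upperCells.1 hC).1 _ fun i hi =>
      eq_zero_of_interp_le hC hμ heq.ge hi]

theorem gMap_eq (hz : ∀ j, z ≤ j) (hC : C ∈ upperCells v (Ψ z)) {x : ℝ × (Fin d → ℝ)}
    (hx : x ∈ coneOver (poly v C)) : gMap v Ψ x = interp v C Ψ.col x := by
  obtain ⟨t, ht, p, hp, rfl⟩ := hx
  have hb := (mem_upperCells.1 hC).1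
  rcases ht.eq_or_lt with rfl | ht
  · simp [gMap]
  · have hfib : lexMax {y | (p, y) ∈ omega v Ψ} = interp v C Ψ.col (1, p) := by
      refine lexMax_eq (mem_omega_iff.2 ⟨bary v C (1, p), (mem_poly_iff_bary hb).1 hp,
        sum_bary hb _, (interp_apply _ _).symm⟩) fun y hy => ?_
      obtain ⟨μ, h0, e, rfl⟩ := mem_omega_iff.1 hy
      rw [← e]
      exact toLex_sum_le_interp hz hC h0
    simp only [gMap, Prod.smul_mk, smul_eq_mul, mul_one, inv_smul_smul₀ ht.ne']
    rw [hfib, ← map_smul, Prod.smul_mk, smul_eq_mul, mul_one]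

theorem exists_upperCell (hv : Function.Injective v) (hspan : affineSpan ℝ (Set.range v) = ⊤)
    (hh : IsGenericHeight v h) {x : ℝ × (Fin d → ℝ)} (hx : x ∈ coneOver (poly v Finset.univ)) :
    ∃ C ∈ upperCells v h, x ∈ coneOver (poly v C) := by
  obtain ⟨t, ht, p, hp, rfl⟩ := hx
  rw [← iUnion_upperCells hv hspan hh] at hp
  obtain ⟨C, hC, hpC⟩ := Set.mem_iUnion₂.1 hp
  exact ⟨C, hC, t, ht, p, hpC, rfl⟩

theorem univ_nonempty_of_span (hspan : affineSpan ℝ (Set.range v) = ⊤) :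
    (Finset.univ : Finset (Fin r)).Nonempty := by
  rw [Finset.nonempty_iff_ne_empty]
  intro he
  have : Set.range v = ∅ := by rw [← Set.image_univ, ← Finset.coe_univ, he]; simp
  rw [this, AffineSubspace.span_empty] at hspan
  exact AffineSubspace.bot_ne_top ℝ _ _ hspan

theorem sum_homog_mem_cone (hspan : affineSpan ℝ (Set.range v) = ⊤) {μ : Fin r → ℝ}
    (hμ : ∀ i, 0 ≤ μ i) : ∑ i, μ i • homog v i ∈ coneOver (poly v Finset.univ) :=
  (mem_coneOver_poly_iff (univ_nonempty_of_span hspan)).2 ⟨μ, hμ, by simp, rfl⟩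

/-- On `K(P)` the map `g_Ψ` dominates every lift of a nonnegative combination. -/
theorem toLex_sum_le_gMap (hv : Function.Injective v) (hspan : affineSpan ℝ (Set.range v) = ⊤)
    (hz : ∀ j, z ≤ j) (hh : IsGenericHeight v (Ψ z)) {μ : Fin r → ℝ} (hμ : ∀ i, 0 ≤ μ i) :
    toLex (∑ i, μ i • Ψ.col i) ≤ toLex (gMap v Ψ (∑ i, μ i • homog v i)) := by
  obtain ⟨C, hC, hx⟩ := exists_upperCell hv hspan hh (sum_homog_mem_cone hspan hμ)
  rw [gMap_eq hz hC hx]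
  exact toLex_sum_le_interp hz hC hμ

/-- Every point of `K(P)` has a representation whose lift is the value of `g_Ψ`. -/
theorem exists_weights_gMap (hv : Function.Injective v) (hspan : affineSpan ℝ (Set.range v) = ⊤)
    (hz : ∀ j, z ≤ j) (hh : IsGenericHeight v (Ψ z)) {x : ℝ × (Fin d → ℝ)}
    (hx : x ∈ coneOver (poly v Finset.univ)) :
    ∃ C ∈ upperCells v (Ψ z), ∃ μ : Fin r → ℝ, (∀ i, 0 ≤ μ i) ∧ (∀ i, i ∉ C → μ i = 0) ∧
      ∑ i, μ i • homog v i = x ∧ gMap v Ψ x = ∑ i, μ i • Ψ.col i := by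
  obtain ⟨C, hC, hxC⟩ := exists_upperCell hv hspan hh hx
  have hb := (mem_upperCells.1 hC).1
  exact ⟨C, hC, bary v C x, (mem_coneOver_iff_bary hb).1 hxC, fun i hi => bary_eq_zero x hi,
    sum_bary hb x, by rw [gMap_eq hz hC hxC, interp_apply]⟩

theorem isClosed_coneOver (hC : IsAffBasis v C) : IsClosed (coneOver (poly v C)) := by
  have : coneOver (poly v C) = ⋂ i, {x | 0 ≤ bary v C x i} := by
    ext x; simp [mem_coneOver_iff_bary hC]
  rw [this]
  refine isClosed_iInter fun i => isClosed_le continuous_const ?_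
  exact (continuous_apply i).comp (LinearMap.continuous_of_finiteDimensional (bary v C))

theorem continuousOn_gMap (hv : Function.Injective v) (hspan : affineSpan ℝ (Set.range v) = ⊤)
    (hz : ∀ j, z ≤ j) (hh : IsGenericHeight v (Ψ z)) :
    ContinuousOn (gMap v Ψ) (coneOver (poly v Finset.univ)) := by
  have hsub : coneOver (poly v Finset.univ) ⊆
      ⋃ C : upperCells v (Ψ z), coneOver (poly v C.1) := fun x hx => by
    obtain ⟨C, hC, hxC⟩ := exists_upperCell hv hspan hh hx
    exact Set.mem_iUnion.2 ⟨⟨C, hC⟩, hxC⟩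
  refine ContinuousOn.mono ?_ hsub
  refine (locallyFinite_of_finite _).continuousOn_iUnion
    (fun C => isClosed_coneOver (mem_upperCells.1 C.2).1) fun C => ?_
  exact (LinearMap.continuous_of_finiteDimensional (interp v C.1 Ψ.col)).continuousOn.congr
    fun x hx => gMap_eq hz C.2 hx

theorem isGKZMap_gMap (hv : Function.Injective v) (hspan : affineSpan ℝ (Set.range v) = ⊤)
    (hz : ∀ j, z ≤ j) (hh : IsGenericHeight v (Ψ z)) :
    IsGKZMap v (upperCells v (Ψ z)) Ψ (gMap v Ψ) where
  linear C hC := ⟨interp v C Ψ.col, fun x hx => gMap_eq hz hC hx⟩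
  convex := by
    refine ⟨continuousOn_gMap hv hspan hz hh, fun x hx y hy t ht ht1 => ?_⟩
    obtain ⟨-, -, μ, hμ, -, rfl, eμ⟩ := exists_weights_gMap hv hspan hz hh hx
    obtain ⟨-, -, ν, hν, -, rfl, eν⟩ := exists_weights_gMap hv hspan hz hh hy
    have hcomb : ∀ {F : Type} [AddCommGroup F] [Module ℝ F] (f : Fin r → F),
        t • ∑ i, μ i • f i + (1 - t) • ∑ i, ν i • f i =
          ∑ i, (t • μ + (1 - t) • ν) i • f i := fun f => by
      simp [add_smul, mul_smul, Finset.sum_add_distrib, Finset.smul_sum]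
    rw [eμ, eν, hcomb, hcomb]
    exact toLex_sum_le_gMap hv hspan hz hh fun i =>
      add_nonneg (mul_nonneg ht (hμ i)) (mul_nonneg (sub_nonneg.2 ht1) (hν i))
  eq_marked C hC i hi := by
    have hb := (mem_upperCells.1 hC).1
    rw [gMap_eq hz hC (one_mem_coneOver_iff.2 (subset_convexHull ℝ _ ⟨i, hi, rfl⟩))]
    exact interp_homog hb _ hi
  le_unmarked i _ := by
    have := toLex_sum_le_gMap (μ := Pi.single i 1) hv hspan hz hh fun j => by
      by_cases hj : j = i
      · subst hj; simp
      · simp [hj]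
    have e : ∀ {F : Type} [AddCommGroup F] [Module ℝ F] (f : Fin r → F),
        ∑ j, (Pi.single i 1 : Fin r → ℝ) j • f j = f i := fun f => by
      rw [Finset.sum_eq_single i] <;> simp +contextual
    rwa [e, e] at this

theorem toLex_col_lt_gMap (hv : Function.Injective v) (hspan : affineSpan ℝ (Set.range v) = ⊤)
    (hz : ∀ j, z ≤ j) (hh : IsGenericHeight v (Ψ z)) {i : Fin r}
    (hi : ∀ C ∈ upperCells v (Ψ z), i ∉ C) : toLex (Ψ.col i) < toLex (gMap v Ψ (1, v i)) := by
  obtain ⟨C, hC, hx⟩ := exists_upperCell (x := (1, v i)) hv hspan hh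
    (one_mem_coneOver_iff.2 (subset_convexHull ℝ _ ⟨i, by simp, rfl⟩))
  rw [gMap_eq hz hC hx]
  refine toLex_lt_of_first hz ?_
  rw [interp_col_apply]
  exact (mem_upperCells.1 hC).2 i (hi C hC)

/-! ### Domains of linearity -/

/-- Two linear maps agreeing at height one over a nonempty open set agree at height one. -/
theorem eq_of_eqOn_open {F : Type*} [AddCommGroup F] [Module ℝ F]
    {φ ψ : (ℝ × (Fin d → ℝ)) →ₗ[ℝ] F} {V : Set (Fin d → ℝ)} (hV : IsOpen V) (hne : V.Nonempty)
    (e : ∀ q ∈ V, φ (1, q) = ψ (1, q)) (p : Fin d → ℝ) : φ (1, p) = ψ (1, p) := by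
  obtain ⟨q, hq⟩ := hne
  have hc : Filter.Tendsto (fun s : ℝ => q + s • (p - q)) (nhdsWithin 0 {0}ᶜ) (nhds q) := by
    have : Continuous fun s : ℝ => q + s • (p - q) := by fun_prop
    have := this.tendsto 0
    rw [zero_smul, add_zero] at this
    exact this.mono_left nhdsWithin_le_nhds
  obtain ⟨s, hs, hs0⟩ := ((hc.eventually (hV.mem_nhds hq)).and self_mem_nhdsWithin).exists
  have hs0 : s ≠ 0 := hs0
  have hp : ((1 : ℝ), p) = (1, q) + s⁻¹ • (((1 : ℝ), q + s • (p - q)) - (1, q)) := by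
    ext <;> simp [hs0]
  rw [hp, map_add, map_smul, map_sub, map_add, map_smul, map_sub, e q hq, e _ hs]

/-- The linear map of the cell `C` agrees with `g_Ψ` only on `C`: elsewhere in `P` its first
coordinate is strictly larger. -/
theorem mem_poly_of_gMap_eq (hv : Function.Injective v)
    (hspan : affineSpan ℝ (Set.range v) = ⊤) (hz : ∀ j, z ≤ j) (hh : IsGenericHeight v (Ψ z))
    (hC : C ∈ upperCells v (Ψ z)) {p : Fin d → ℝ} (hp : p ∈ poly v Finset.univ)
    (e : gMap v Ψ (1, p) = interp v C Ψ.col (1, p)) : p ∈ poly v C := by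
  obtain ⟨C', hC', hx⟩ := exists_upperCell hv hspan hh (one_mem_coneOver_iff.2 hp)
  rw [gMap_eq hz hC' hx] at e
  have := congrFun e z
  rw [interp_col_apply, interp_col_apply] at this
  exact one_mem_coneOver_iff.1 (mem_coneOver_of_interp_le hC' hC hx this.ge)

theorem isDomainIn_poly (hC : IsAffBasis v C) :
    IsDomainIn (poly v Finset.univ) (poly v C) :=
  ⟨interior (poly v C), isOpen_interior,
    ⟨interior_poly_nonempty hC.2, convex_poly.interior.isPreconnected⟩,
    interior_subset.trans (poly_mono (Finset.subset_univ C)), (closure_interior_poly hC.2).symm⟩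

theorem exists_cell_of_linearOn (hv : Function.Injective v)
    (hspan : affineSpan ℝ (Set.range v) = ⊤) (hz : ∀ j, z ≤ j) (hh : IsGenericHeight v (Ψ z))
    {D : Set (Fin d → ℝ)} (hD : IsDomainIn (poly v Finset.univ) D)
    (hlin : LinearOn (gMap v Ψ) (coneOver D)) : ∃ C ∈ upperCells v (Ψ z), D ⊆ poly v C := by
  obtain ⟨O, hO, ⟨⟨p, hp⟩, -⟩, hOP, rfl⟩ := hD
  obtain ⟨φ, hφ⟩ := hlin
  have hcl : closure O ⊆ poly v Finset.univ := closure_minimal hOP isCompact_poly.isClosed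
  have hpP := hOP hp
  rw [← iUnion_upperCells hv hspan hh] at hpP
  obtain ⟨C, hC, hpC⟩ := Set.mem_iUnion₂.1 hpP
  have hb := (mem_upperCells.1 hC).1
  rw [← closure_interior_poly hb.2] at hpC
  have hne := mem_closure_iff.1 hpC O hO hp
  have heq := eq_of_eqOn_open (φ := φ) (ψ := interp v C Ψ.col) (hO.inter isOpen_interior) hne
    fun q hq => by
      rw [← hφ (one_mem_coneOver_iff.2 (subset_closure hq.1)),
        gMap_eq hz hC (one_mem_coneOver_iff.2 (interior_subset hq.2))]
  refine ⟨C, hC, fun q hq => mem_poly_of_gMap_eq hv hspan hz hh hC (hcl hq) ?_⟩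
  rw [hφ (one_mem_coneOver_iff.2 hq), heq]

theorem isDomainOfLinearity_iff (hv : Function.Injective v)
    (hspan : affineSpan ℝ (Set.range v) = ⊤) (hz : ∀ j, z ≤ j) (hh : IsGenericHeight v (Ψ z))
    (D : Set (Fin d → ℝ)) : IsDomainOfLinearity (poly v Finset.univ) (gMap v Ψ) D ↔
      ∃ C ∈ upperCells v (Ψ z), D = poly v C := by
  have hcell : ∀ C ∈ upperCells v (Ψ z), IsDomainIn (poly v Finset.univ) (poly v C) ∧
      LinearOn (gMap v Ψ) (coneOver (poly v C)) := fun C hC =>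
    ⟨isDomainIn_poly (mem_upperCells.1 hC).1, (isGKZMap_gMap hv hspan hz hh).linear C hC⟩
  constructor
  · rintro ⟨⟨hD, hlin⟩, hmax⟩
    obtain ⟨C, hC, hDC⟩ := exists_cell_of_linearOn hv hspan hz hh hD hlin
    exact ⟨C, hC, subset_antisymm hDC (hmax (hcell C hC) hDC)⟩
  · rintro ⟨C, hC, rfl⟩
    refine ⟨hcell C hC, fun E hE hCE => ?_⟩
    obtain ⟨C', hC', hEC'⟩ := exists_cell_of_linearOn hv hspan hz hh hE.1 hE.2
    -- the vertices of `C` lie in `C'`, so the affine bases `C` and `C'` coincide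
    have hCC' : C ⊆ C' := fun i hi =>
      mem_of_mem_poly hC hC' (hEC' (hCE (subset_convexHull ℝ _ ⟨i, hi, rfl⟩))) hi
    rw [(mem_upperCells.1 hC').1.eq_of_subset (mem_upperCells.1 hC).1 hCC']
    exact hEC'

theorem mem_openCone_upperCells (hv : Function.Injective v)
    (hspan : affineSpan ℝ (Set.range v) = ⊤) (hz : ∀ j, z ≤ j)
    (hh : IsGenericHeight v (Ψ z)) : Ψ ∈ openCone v (upperCells v (Ψ z)) N :=
  ⟨gMap v Ψ, isGKZMap_gMap hv hspan hz hh, isDomainOfLinearity_iff hv hspan hz hh,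
    fun _ hi => toLex_col_lt_gMap hv hspan hz hh hi⟩

end Triangulation

/-! ### Generic matrices -/

theorem dense_of_finite_compl_on_lines {E : Type*} [TopologicalSpace E] [AddCommGroup E]
    [Module ℝ E] [ContinuousAdd E] [ContinuousSMul ℝ E] {G : Set E}
    (hG : ∀ x, ∃ e : E, {t : ℝ | x + t • e ∉ G}.Finite) : Dense G := by
  intro x
  obtain ⟨e, he⟩ := hG x
  have hc : Filter.Tendsto (fun t : ℝ => x + t • e) (nhdsWithin 0 {0}ᶜ) (nhds x) := by
    have : Continuous fun t : ℝ => x + t • e := by fun_prop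
    have := this.tendsto 0
    rw [zero_smul, add_zero] at this
    exact this.mono_left nhdsWithin_le_nhds
  refine mem_closure_of_tendsto hc ?_
  have hfin : ({t : ℝ | x + t • e ∉ G} \ {0})ᶜ ∈ nhds (0 : ℝ) :=
    (he.subset Set.sdiff_subset).isClosed.isOpen_compl.mem_nhds (by simp)
  filter_upwards [nhdsWithin_le_nhds hfin, self_mem_nhdsWithin] with t ht ht0
  by_contra hcon
  exact ht ⟨hcon, ht0⟩

theorem isOpen_dense_iInter {ι X : Type*} [Finite ι] [TopologicalSpace X] {f : ι → Set X}
    (hf : ∀ i, IsOpen (f i) ∧ Dense (f i)) : IsOpen (⋂ i, f i) ∧ Dense (⋂ i, f i) := by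
  classical
  have := Fintype.ofFinite ι
  have key : ∀ s : Finset ι, IsOpen (⋂ i ∈ s, f i) ∧ Dense (⋂ i ∈ s, f i) := by
    intro s
    induction s using Finset.induction_on with
    | empty => simp
    | insert a s _ ih =>
      rw [Finset.set_biInter_insert]
      exact ⟨(hf a).1.inter ih.1, (hf a).2.inter_of_isOpen_left ih.2 (hf a).1⟩
  simpa using key Finset.univ

section Generic

variable {d r N : ℕ} {v : Fin r → (Fin d → ℝ)}

/-- The first row is a generic height function and any at most `N` columns are linearly
independent. The first row determines the triangulation, the columns govern the fibres
of `g_Ψ`. -/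
def IsGenericMatrix (v : Fin r → (Fin d → ℝ)) (z : Fin N) (Ψ : Matrix (Fin N) (Fin r) ℝ) : Prop :=
  IsGenericHeight v (Ψ z) ∧
    ∀ I : Finset (Fin r), I.card ≤ N → LinearIndependent ℝ fun i : I => Ψ.col i

theorem isOpen_dense_height (z : Fin N) {C : Finset (Fin r)} {k : Fin r} (hk : k ∉ C) :
    IsOpen {Ψ : Matrix (Fin N) (Fin r) ℝ | Ψ z k ≠ interp v C (Ψ z) (homog v k)} ∧
      Dense {Ψ : Matrix (Fin N) (Fin r) ℝ | Ψ z k ≠ interp v C (Ψ z) (homog v k)} := by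
  constructor
  · simp only [interp_apply]
    exact isOpen_ne_fun (by fun_prop) (by fun_prop)
  · refine dense_of_finite_compl_on_lines fun Ψ => ⟨Matrix.single z k 1, ?_⟩
    refine (Set.finite_singleton (interp v C (Ψ z) (homog v k) - Ψ z k)).subset fun t ht => ?_
    have e : interp v C ((Ψ + t • Matrix.single z k (1 : ℝ)) z) (homog v k) =
        interp v C (Ψ z) (homog v k) := by
      simp only [interp_apply]
      refine Finset.sum_congr rfl fun i _ => ?_
      by_cases hi : i ∈ C
      · have : k ≠ i := by rintro rfl; exact hk hi
        simp [this]
      · simp [bary_eq_zero _ hi]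
    simp only [Set.mem_ofPred_eq, not_not, e] at ht
    rw [Set.mem_singleton_iff, ← ht]
    simp

theorem isOpen_dense_det {I : Finset (Fin r)} (e : I ↪ Fin N) :
    IsOpen {Ψ : Matrix (Fin N) (Fin r) ℝ | (Ψ.submatrix e ((↑) : I → Fin r)).det ≠ 0} ∧
      Dense {Ψ : Matrix (Fin N) (Fin r) ℝ | (Ψ.submatrix e ((↑) : I → Fin r)).det ≠ 0} := by
  classical
  constructor
  · exact isOpen_ne_fun (by fun_prop) continuous_const
  · refine dense_of_finite_compl_on_lines fun Ψ =>
      ⟨Matrix.of fun a i => if ∃ hi : i ∈ I, a = e ⟨i, hi⟩ then 1 else 0, ?_⟩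
    refine (Polynomial.finite_setOfPred_isRoot
      (Matrix.charpoly_monic (-(Ψ.submatrix e ((↑) : I → Fin r)))).ne_zero).subset fun t ht => ?_
    simp only [Set.mem_ofPred_eq, not_not] at ht
    rw [Set.mem_ofPred_eq, Polynomial.IsRoot, Matrix.eval_charpoly, ← ht]
    congr 1
    ext i j
    simp [Matrix.scalar_apply, Matrix.diagonal_apply, add_comm]

theorem linearIndependent_of_det {I : Finset (Fin r)} (e : I ↪ Fin N)
    {Ψ : Matrix (Fin N) (Fin r) ℝ} (h : (Ψ.submatrix e ((↑) : I → Fin r)).det ≠ 0) :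
    LinearIndependent ℝ fun i : I => Ψ.col i := by
  refine LinearIndependent.of_comp (LinearMap.funLeft ℝ ℝ e) ?_
  exact Matrix.linearIndependent_cols_iff_isUnit.2
    ((Matrix.isUnit_iff_isUnit_det _).2 (isUnit_iff_ne_zero.2 h))

theorem exists_isOpen_dense_isGenericMatrix (v : Fin r → (Fin d → ℝ)) (z : Fin N) :
    ∃ U : Set (Matrix (Fin N) (Fin r) ℝ), IsOpen U ∧ Dense U ∧
      ∀ Ψ ∈ U, IsGenericMatrix v z Ψ := by
  let ι₁ := {q : Finset (Fin r) × Fin r // q.2 ∉ q.1}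
  let ι₂ := {I : Finset (Fin r) // I.card ≤ N}
  have hemb : ∀ I : ι₂, Nonempty (I.1 ↪ Fin N) := fun I =>
    Function.Embedding.nonempty_of_card_le (by simpa using I.2)
  let e := fun I => (hemb I).some
  have h1 := isOpen_dense_iInter fun q : ι₁ => isOpen_dense_height (v := v) z q.2
  have h2 := isOpen_dense_iInter fun I : ι₂ => isOpen_dense_det (e I)
  refine ⟨_, h1.1.inter h2.1, h1.2.inter_of_isOpen_left h2.2 h1.1, fun Ψ hΨ => ⟨?_, ?_⟩⟩
  · exact fun C _ k hk => Set.mem_iInter.1 hΨ.1 ⟨(C, k), hk⟩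
  · exact fun I hI => linearIndependent_of_det (e ⟨I, hI⟩) (Set.mem_iInter.1 hΨ.2 ⟨I, hI⟩)

variable {z : Fin N} {Ψ : Matrix (Fin N) (Fin r) ℝ}

theorem weights_eq_of_sum_col_eq
    (hcol : ∀ I : Finset (Fin r), I.card ≤ N → LinearIndependent ℝ fun i : I => Ψ.col i)
    {I : Finset (Fin r)} (hI : I.card ≤ N) {μ ν : Fin r → ℝ} (hμ : ∀ i, i ∉ I → μ i = 0)
    (hν : ∀ i, i ∉ I → ν i = 0) (e : ∑ i, μ i • Ψ.col i = ∑ i, ν i • Ψ.col i) : μ = ν := by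
  have key := Fintype.linearIndependent_iff.1 (hcol I hI) fun i => μ i - ν i
  rw [sum_subtype_of_eq_zero (g := fun i => (μ i - ν i) • Ψ.col i) fun i hi => by
    simp [hμ i hi, hν i hi]] at key
  have := key (by simp only [sub_smul]; rw [Finset.sum_sub_distrib, e, sub_self])
  funext i
  by_cases hi : i ∈ I
  · exact sub_eq_zero.1 (this ⟨i, hi⟩)
  · rw [hμ i hi, hν i hi]

/-- Two points in the cones over two simplices are told apart by the at most
`min (2 * (d + 1)) r` columns at the vertices of the two simplices. -/
theorem injOn_gMap (hv : Function.Injective v) (hspan : affineSpan ℝ (Set.range v) = ⊤)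
    (hz : ∀ j, z ≤ j) (hN : min (2 * (d + 1)) r ≤ N) (hΨ : IsGenericMatrix v z Ψ) :
    Set.InjOn (gMap v Ψ) (coneOver (poly v Finset.univ)) := by
  intro x hx y hy hxy
  obtain ⟨C, hC, μ, -, hμ, rfl, ex⟩ := exists_weights_gMap hv hspan hz hΨ.1 hx
  obtain ⟨C', hC', ν, -, hν, rfl, ey⟩ := exists_weights_gMap hv hspan hz hΨ.1 hy
  have hcard : (C ∪ C').card ≤ N := by
    have h1 := (mem_upperCells.1 hC).1.card_le
    have h2 := (mem_upperCells.1 hC').1.card_le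
    have h3 := Finset.card_union_le C C'
    have h4 := Finset.card_le_univ (C ∪ C')
    rw [Fintype.card_fin] at h4
    omega
  rw [weights_eq_of_sum_col_eq hΨ.2 hcard (μ := μ) (ν := ν)
    (fun i hi => hμ i fun h => hi (Finset.mem_union_left _ h))
    (fun i hi => hν i fun h => hi (Finset.mem_union_right _ h)) (by rw [← ex, ← ey, hxy])]

theorem ker_interp_col (hN : min (2 * (d + 1)) r ≤ N) (hΨ : IsGenericMatrix v z Ψ)
    {C : Finset (Fin r)} (hC : IsAffBasis v C) : LinearMap.ker (interp v C Ψ.col) = ⊥ := by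
  refine LinearMap.ker_eq_bot'.2 fun x hx => ?_
  have hcard : C.card ≤ N := by
    have h1 := hC.card_le
    have h4 := Finset.card_le_univ C
    rw [Fintype.card_fin] at h4
    omega
  have := weights_eq_of_sum_col_eq hΨ.2 hcard (μ := bary v C x) (ν := 0)
    (fun i hi => bary_eq_zero x hi) (fun _ _ => rfl) (by rw [← interp_apply, hx]; simp)
  rw [← sum_bary hC x, this]
  simp

end Generic

/-! ### Lattice points -/

section Lattice

variable {d r N : ℕ}

/-- An element of `ℤ × ℤ^d` as a point of `ℝ × ℝ^d`. -/
def latticePoint (u : ℤ × (Fin d → ℤ)) : ℝ × (Fin d → ℝ) := ((u.1 : ℝ), fun j => (u.2 j : ℝ))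

theorem latticePoint_injective : Function.Injective (latticePoint (d := d)) := by
  intro u w h
  obtain ⟨h1, h2⟩ := Prod.ext_iff.1 h
  exact Prod.ext (Int.cast_injective h1) (funext fun j => Int.cast_injective (congrFun h2 j))

theorem latticePoint_add (u w : ℤ × (Fin d → ℤ)) :
    latticePoint (u + w) = latticePoint u + latticePoint w := by
  ext <;> simp [latticePoint]

theorem finite_latticePoint_preimage {s : Set (ℝ × (Fin d → ℝ))} (hs : Bornology.IsBounded s) :
    (latticePoint ⁻¹' s).Finite := by
  classical
  obtain ⟨R, hR⟩ := hs.exists_norm_le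
  refine (Set.finite_Icc (-⌈R⌉, fun _ => -⌈R⌉) (⌈R⌉, fun _ => ⌈R⌉)).subset fun u hu => ?_
  have hle := hR _ hu
  have key : ∀ a : ℤ, |(a : ℝ)| ≤ R → -⌈R⌉ ≤ a ∧ a ≤ ⌈R⌉ := by
    intro a ha
    have h1 : |(a : ℝ)| ≤ (⌈R⌉ : ℝ) := ha.trans (Int.le_ceil R)
    exact abs_le.1 (by exact_mod_cast h1)
  have h1 := key u.1 ((norm_fst_le (latticePoint u)).trans hle)
  have h2 : ∀ j, _ := fun j => key (u.2 j)
    ((norm_le_pi_norm (latticePoint u).2 j).trans ((norm_snd_le (latticePoint u)).trans hle))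
  exact ⟨⟨h1.1, fun j => (h2 j).1⟩, ⟨h1.2, fun j => (h2 j).2⟩⟩

theorem latticePoint_mem_cone {χ : Fin r → (Fin d → ℤ)}
    (hspan : affineSpan ℝ (Set.range (realPoints χ)) = ⊤) (u : monoidS χ) :
    latticePoint u.1 ∈ coneOver (poly (realPoints χ) Finset.univ) := by
  obtain ⟨α, hα⟩ := exists_weight_eq χ u
  have : latticePoint u.1 = ∑ i, (α i : ℝ) • homog (realPoints χ) i := by
    rw [← hα, weight, Finsupp.sum_fintype _ _ (by simp), sum_smul_homog]
    ext <;> simp [latticePoint, realPoints, Finset.sum_apply, Prod.fst_sum, Prod.snd_sum]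
  rw [this]
  exact sum_homog_mem_cone hspan fun i => Nat.cast_nonneg _

theorem discreteTopology_of_finite_inter_closedBall {E : Type*} [PseudoMetricSpace E] [T1Space E]
    {s : Set E} (h : ∀ x, (s ∩ Metric.closedBall x 1).Finite) : DiscreteTopology s := by
  refine discreteTopology_subtype_iff.2 fun x _ => ?_
  have h1 : ((s ∩ Metric.closedBall x 1) \ {x})ᶜ ∈ nhds x :=
    ((h x).subset Set.sdiff_subset).isClosed.isOpen_compl.mem_nhds (by simp)
  rw [← Filter.empty_mem_iff_bot]
  filter_upwards [Filter.mem_inf_of_left (nhdsWithin_le_nhds h1),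
    Filter.mem_inf_of_left (nhdsWithin_le_nhds (Metric.closedBall_mem_nhds x one_pos)),
    Filter.mem_inf_of_left self_mem_nhdsWithin,
    Filter.mem_inf_of_right (Filter.mem_principal_self s)] with y hy1 hy2 hy3 hy4
  exact hy1 ⟨⟨hy4, hy2⟩, hy3⟩

/-- `g_Ψ` takes only finitely many values in a bounded set at lattice points of `K(P)`, since it is
given on finitely many cones by injective linear maps. -/
theorem discreteTopology_gMap_image {v : Fin r → (Fin d → ℝ)} {z : Fin N}
    {Ψ : Matrix (Fin N) (Fin r) ℝ} (hv : Function.Injective v)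
    (hspan : affineSpan ℝ (Set.range v) = ⊤)
    (hz : ∀ j, z ≤ j) (hN : min (2 * (d + 1)) r ≤ N) (hΨ : IsGenericMatrix v z Ψ) :
    DiscreteTopology (gMap v Ψ '' (coneOver (poly v Finset.univ) ∩ Set.range latticePoint)) := by
  refine discreteTopology_of_finite_inter_closedBall fun a => ?_
  have hfin : ∀ C ∈ upperCells v (Ψ z),
      (interp v C Ψ.col '' (latticePoint '' (latticePoint ⁻¹'
        (interp v C Ψ.col ⁻¹' Metric.closedBall a 1)))).Finite := by
    intro C hC
    have hemb := LinearMap.isClosedEmbedding_of_injective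
      (ker_interp_col hN hΨ (mem_upperCells.1 hC).1)
    have hcpt := hemb.isCompact_preimage (isCompact_closedBall a 1)
    exact ((finite_latticePoint_preimage hcpt.isBounded).image _).image _
  refine ((upperCells v (Ψ z)).finite_toSet.biUnion hfin).subset ?_
  rintro _ ⟨⟨_, ⟨hx, u, rfl⟩, rfl⟩, hball⟩
  obtain ⟨C, hC, hxC⟩ := exists_upperCell hv hspan hΨ.1 hx
  rw [gMap_eq hz hC hxC] at hball ⊢
  exact Set.mem_iUnion₂.2 ⟨C, hC, _, ⟨u, hball, rfl⟩, rfl⟩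

end Lattice

/-! ### The quasi-valuation -/

section Valuation

variable {d r N : ℕ} {K : Type*} [Field K] {χ : Fin r → (Fin d → ℤ)}

theorem fElt_mul (u w : monoidS χ) : fElt K χ u * fElt K χ w = fElt K χ (u + w) := by
  have hw : weight χ ((exists_weight_eq χ u).choose + (exists_weight_eq χ w).choose) =
      ((u + w : monoidS χ) : ℤ × (Fin d → ℤ)) := by
    have : ∀ α β : Fin r →₀ ℕ, weight χ (α + β) = weight χ α + weight χ β := fun α β =>
      Finsupp.sum_add_index' (fun _ => zero_smul _ _) fun _ _ _ => add_smul _ _ _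
    rw [this, (exists_weight_eq χ u).choose_spec, (exists_weight_eq χ w).choose_spec]
    rfl
  rw [fElt, fElt, ← map_mul, MvPolynomial.monomial_mul, one_mul, mk_monomial_eq]
  exact congrArg _ (Subtype.ext hw)

variable [CharZero K]

theorem fBasis_apply (u : monoidS χ) : fBasis K χ u = fElt K χ u :=
  Module.Basis.mk_apply _ _ u

theorem exists_add_of_mem_support_mul {x y : CoordRing K χ} {u : monoidS χ}
    (hu : u ∈ ((fBasis K χ).repr (x * y)).support) :
    ∃ a ∈ ((fBasis K χ).repr x).support, ∃ b ∈ ((fBasis K χ).repr y).support, a + b = u := by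
  have hx := (fBasis K χ).linearCombination_repr x
  have hy := (fBasis K χ).linearCombination_repr y
  rw [Finsupp.linearCombination_apply, Finsupp.sum] at hx hy
  have hxy : (fBasis K χ).repr (x * y) = ∑ a ∈ ((fBasis K χ).repr x).support,
      ∑ b ∈ ((fBasis K χ).repr y).support,
        Finsupp.single (a + b) ((fBasis K χ).repr x a * (fBasis K χ).repr y b) := by
    conv_lhs => rw [← hx, ← hy, Finset.sum_mul_sum]
    simp only [map_sum]
    refine Finset.sum_congr rfl fun a _ => Finset.sum_congr rfl fun b _ => ?_
    rw [fBasis_apply, fBasis_apply, smul_mul_smul_comm, fElt_mul, ← fBasis_apply, map_smul,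
      Module.Basis.repr_self, Finsupp.smul_single, smul_eq_mul, mul_one]
  rw [Finsupp.mem_support_iff, hxy, Finsupp.finsetSum_apply] at hu
  obtain ⟨a, ha, hne⟩ := Finset.exists_ne_zero_of_sum_ne_zero hu
  rw [Finsupp.finsetSum_apply] at hne
  obtain ⟨b, hb, hne⟩ := Finset.exists_ne_zero_of_sum_ne_zero hne
  refine ⟨a, ha, b, hb, ?_⟩
  by_contra h
  exact hne (Finsupp.single_eq_of_ne (Ne.symm h))

variable {Ψ : Matrix (Fin N) (Fin r) ℝ}

theorem le_vMap_iff {a : WithTop (Lex (Fin N → ℝ))} {x : CoordRing K χ} :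
    a ≤ vMap K χ Ψ x ↔ ∀ u ∈ ((fBasis K χ).repr x).support,
      a ≤ (toLex (gMap (realPoints χ) Ψ (latticePoint u.1)) : Lex (Fin N → ℝ)) :=
  Finset.le_inf_iff

theorem coe_lt_vMap_iff {a : Lex (Fin N → ℝ)} {x : CoordRing K χ} :
    (a : WithTop (Lex (Fin N → ℝ))) < vMap K χ Ψ x ↔ ∀ u ∈ ((fBasis K χ).repr x).support,
      a < toLex (gMap (realPoints χ) Ψ (latticePoint u.1)) := by
  refine (Finset.lt_inf_iff (WithTop.coe_lt_top a)).trans ?_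
  simp only [WithTop.coe_lt_coe]
  rfl

theorem vMap_le {x : CoordRing K χ} {u : monoidS χ} (hu : u ∈ ((fBasis K χ).repr x).support) :
    vMap K χ Ψ x ≤ (toLex (gMap (realPoints χ) Ψ (latticePoint u.1)) : Lex (Fin N → ℝ)) :=
  le_vMap_iff.1 le_rfl u hu

theorem vMap_eq_coe {x : CoordRing K χ} {a : Lex (Fin N → ℝ)} (h : vMap K χ Ψ x = a) :
    ∃ u : monoidS χ, toLex (gMap (realPoints χ) Ψ (latticePoint u.1)) = a := by
  by_contra! hcon
  have : (a : WithTop (Lex (Fin N → ℝ))) < vMap K χ Ψ x := coe_lt_vMap_iff.2 fun u hu =>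
    lt_of_le_of_ne (WithTop.coe_le_coe.1 (h ▸ vMap_le hu)) (hcon u).symm
  exact this.ne h.symm

variable {z : Fin N}

theorem isQuasiValuation_vMap (hv : Function.Injective (realPoints χ))
    (hspan : affineSpan ℝ (Set.range (realPoints χ)) = ⊤) (hz : ∀ j, z ≤ j)
    (hN : min (2 * (d + 1)) r ≤ N) (hΨ : IsGenericMatrix (realPoints χ) z Ψ) :
    IsQuasiValuation K (vMap K χ Ψ) where
  eq_top_iff x := by
    constructor
    · intro hx
      rw [← (fBasis K χ).repr.map_eq_zero_iff, ← Finsupp.support_eq_empty]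
      refine Finset.eq_empty_of_forall_notMem fun u hu => ?_
      exact absurd (hx ▸ vMap_le hu) (not_le.2 (WithTop.coe_lt_top _))
    · rintro rfl
      simp [vMap]
  min_le_add x y := le_vMap_iff.2 fun u hu => by
    classical
    rw [map_add] at hu
    rcases Finset.mem_union.1 (Finsupp.support_add hu) with h | h
    · exact (min_le_left _ _).trans (vMap_le h)
    · exact (min_le_right _ _).trans (vMap_le h)
  map_smul c x hc := by
    rw [vMap, vMap, map_smul, Finsupp.support_smul_eq hc]
  add_le_mul x y := le_vMap_iff.2 fun u hu => by
    obtain ⟨a, ha, b, hb, rfl⟩ := exists_add_of_mem_support_mul hu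
    refine (add_le_add (vMap_le ha) (vMap_le hb)).trans ?_
    rw [← WithTop.coe_add, WithTop.coe_le_coe, ← toLex_add, AddSubmonoid.coe_add,
      latticePoint_add]
    obtain ⟨-, -, μ, hμ, -, eμ, gμ⟩ :=
      exists_weights_gMap hv hspan hz hΨ.1 (latticePoint_mem_cone hspan a)
    obtain ⟨-, -, ν, hν, -, eν, gν⟩ :=
      exists_weights_gMap hv hspan hz hΨ.1 (latticePoint_mem_cone hspan b)
    rw [gμ, gν, ← eμ, ← eν]
    have := toLex_sum_le_gMap (μ := μ + ν) hv hspan hz hΨ.1 fun i => add_nonneg (hμ i) (hν i)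
    simpa only [Pi.add_apply, add_smul, Finset.sum_add_distrib] using this
  discrete := by
    have := discreteTopology_gMap_image hv hspan hz hN hΨ
    refine DiscreteTopology.of_subset this ?_
    rintro a ⟨x, hx⟩
    obtain ⟨u, hu⟩ := vMap_eq_coe hx
    exact ⟨latticePoint u.1, ⟨latticePoint_mem_cone hspan u, u.1, rfl⟩, toLex.injective hu⟩

/-- A leaf is spanned by the single `f_u` whose value is the given one, if there is any. -/
theorem fullRank_vMap (hspan : affineSpan ℝ (Set.range (realPoints χ)) = ⊤)
    (hinj : Set.InjOn (gMap (realPoints χ) Ψ) (coneOver (poly (realPoints χ) Finset.univ)))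
    (h : IsQuasiValuation K (vMap K χ Ψ)) : h.FullRank := by
  intro a
  rw [rank_le_one_iff]
  by_cases hex : ∃ u : monoidS χ, toLex (gMap (realPoints χ) Ψ (latticePoint u.1)) = a
  · obtain ⟨u, hu⟩ := hex
    have huniq : ∀ w : monoidS χ,
        toLex (gMap (realPoints χ) Ψ (latticePoint w.1)) = a → w = u := fun w hw =>
      Subtype.ext (latticePoint_injective (hinj (latticePoint_mem_cone hspan w)
        (latticePoint_mem_cone hspan u) (toLex.injective (hw.trans hu.symm))))
    have hmem : fBasis K χ u ∈ h.ge a := le_vMap_iff.2 fun w hw => by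
      rw [Module.Basis.repr_self] at hw
      have := Finset.mem_singleton.1 (Finsupp.support_single_subset hw)
      rw [this, hu]
    refine ⟨Submodule.Quotient.mk ⟨fBasis K χ u, hmem⟩, fun y => ?_⟩
    obtain ⟨⟨x, hx⟩, rfl⟩ := Submodule.Quotient.mk_surjective _ y
    refine ⟨(fBasis K χ).repr x u, ?_⟩
    rw [← Submodule.Quotient.mk_smul]
    refine ((Submodule.Quotient.eq _).2 ?_).symm
    rw [Submodule.submoduleOf, Submodule.mem_comap]
    refine coe_lt_vMap_iff.2 fun w hw => ?_
    rw [Finsupp.mem_support_iff] at hw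
    simp only [map_sub, map_smul, Submodule.subtype_apply, Module.Basis.repr_self,
      Finsupp.sub_apply, Finsupp.smul_apply, smul_eq_mul] at hw
    have hwu : w ≠ u := by
      rintro rfl
      simp at hw
    rw [Finsupp.single_eq_of_ne hwu, mul_zero, sub_zero] at hw
    exact (WithTop.coe_le_coe.1 (le_vMap_iff.1 hx w (Finsupp.mem_support_iff.2 hw))).lt_of_ne
      fun e => hwu (huniq w e.symm)
  · refine ⟨0, fun y => ⟨0, ?_⟩⟩
    obtain ⟨⟨x, hx⟩, rfl⟩ := Submodule.Quotient.mk_surjective _ y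
    rw [smul_zero]
    refine ((Submodule.Quotient.mk_eq_zero _).2 ?_).symm
    rw [Submodule.submoduleOf, Submodule.mem_comap]
    exact coe_lt_vMap_iff.2 fun w hw =>
      (WithTop.coe_le_coe.1 (le_vMap_iff.1 hx w hw)).lt_of_ne fun e => hex ⟨w, e.symm⟩

end Valuation

theorem realPoints_injective {d r : ℕ} {χ : Fin r → (Fin d → ℤ)} (hχ : Function.Injective χ) :
    Function.Injective (realPoints χ) := fun _ _ hij =>
  hχ (funext fun l => Int.cast_injective (congrFun hij l))

end GKZ

theorem mainTheorem9 {K : Type*} [Field K] [IsAlgClosed K] [CharZero K]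
    (n N r : ℕ) (hn : 1 ≤ n)
    (χ : Fin r → (Fin (n - 1) → ℤ)) (hχ : Function.Injective χ)
    (hspan : affineSpan ℝ (Set.range (GKZ.realPoints χ)) = ⊤)
    (hN : min (2 * n) r ≤ N) :
    ∃ U : Set (Matrix (Fin N) (Fin r) ℝ), IsOpen U ∧ Dense U ∧
      ∀ Ψ ∈ U,
        (∃ T : Finset (Finset (Fin r)),
          GKZ.IsTriangulation (GKZ.realPoints χ) T ∧ GKZ.IsRegular (GKZ.realPoints χ) T ∧
            Ψ ∈ GKZ.openCone (GKZ.realPoints χ) T N) ∧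
        ∃ h : GKZ.IsQuasiValuation K (GKZ.vMap K χ Ψ), h.FullRank := by
  have hv := GKZ.realPoints_injective hχ
  have hr : 0 < r := (GKZ.univ_nonempty_of_span hspan).elim fun i _ => i.pos
  have hN' : min (2 * (n - 1 + 1)) r ≤ N := by rwa [Nat.sub_add_cancel hn]
  let z : Fin N := ⟨0, by omega⟩
  have hz : ∀ j, z ≤ j := fun j => Nat.zero_le j
  obtain ⟨U, hU, hUd, hgen⟩ := GKZ.exists_isOpen_dense_isGenericMatrix (GKZ.realPoints χ) z
  refine ⟨U, hU, hUd, fun Ψ hΨ => ⟨⟨GKZ.upperCells (GKZ.realPoints χ) (Ψ z), ?_, ?_, ?_⟩, ?_⟩⟩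
  · exact GKZ.isTriangulation_upperCells hv hspan (hgen Ψ hΨ).1
  · exact GKZ.isRegular_upperCells hv hspan (hgen Ψ hΨ).1
  · exact GKZ.mem_openCone_upperCells hv hspan hz (hgen Ψ hΨ).1
  · exact ⟨GKZ.isQuasiValuation_vMap hv hspan hz hN' (hgen Ψ hΨ), GKZ.fullRank_vMap hspan
      (GKZ.injOn_gMap hv hspan hz hN' (hgen Ψ hΨ)) _⟩
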